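/- Let $(X_k)_{k\ge 1}$ be independent real random variables with $\mathbb E[X_k]=0$ and $\mathrm{Var}(X_k)=1$. Suppose that for every $k$ the law of $X_k$ has a density $p_k$ whose support $\{p_k\neq 0\}$ is an interval and which is differentiable in the interior of that interval. Let $$\tau_k(x)=\frac{1}{p_k(x)}\int_x^\infty y\,p_k(y)\,dy$$ for $x$ in the support of $p_k$ (the Stein kernel of $X_k$), and assume $$\beta:=\max\Big\{\sup_{k\ge1}\mathbb E|X_k|^8,\ \sup_{k\ge1}\mathbb E|\tau_k(X_k)|^8,\ \sup_{k\ge1}\mathbb E|\tau_k'(X_k)|^8\Big\}<\infty .$$ Let $H:\mathbb R\to\mathbb R$ be twice differentiable with $H'$ and $H''$ bounded and $\inf_{x\in\mathbb R}|H'(x)|>0$. For $n\ge1$ put $\bar X=\frac{X_1+\dots+X_n}{n}$ and $$F_n=\sqrt n\,\big(H(\bar X)-\mathbb E[H(\bar X)]\big),\qquad \sigma_n^2=\mathrm{Var}(F_n),\qquad \nabla_{F_n}=\frac{H'(0)H'(\bar X)}{n}\sum_{k=1}^n\tau_k(X_k).$$ For a random variable $F$ with mean $0$ and variance $1$ and $Z\sim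 N(0,1)$, let $I(F\|Z)=\mathbb E\big[(\rho_F(F)+F)^2\big]$, where $\rho_F=p_F'/p_F$, if $F$ has an absolutely continuous density $p_F$, and $I(F\|Z)=\infty$ otherwise. Write $\|Y\|_8=(\mathbb E|Y|^8)^{1/8}$, with the convention $|0|^{-1}=\infty$ in negative moments. Assume that $\mathbb E|\tau_1(X_1)+\dots+\tau_{n_0}(X_{n_0})|^{-8}<\infty$ for some $n_0\ge1$. Then $$\gamma:=\sup_{n\ge n_0}\|\nabla_{F_n}^{-1}\|_8<\infty,$$ and for all $n\ge n_0$ one has $\sigma_n>0$ and $$I(\sigma_n^{-1}F_n\|Z)\le \frac{C_{H,\beta,\gamma}}{n\,\sigma_n^2},$$ where $C_{H,\beta,\gamma}$ is a positive constant depending only on $\beta$, $\gamma$, $\|H'\|_\infty=\sup_x|H'(x)|$ and $\|H''\|_\infty=\sup_x|H''(x)|$. -/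

import Mathlib

open MeasureTheory ProbabilityTheory
open scoped ENNReal

noncomputable section

/-- `p` is a density of the law `ν` on the real line whose support `{p ≠ 0}` is an interval
(bounded or not, with or without its endpoints) and which is differentiable inside it. -/
structure IsIntervalDensity (ν : Measure ℝ) (p : ℝ → ℝ) : Prop where
  nonneg : ∀ x, 0 ≤ p x
  eq_withDensity : ν = volume.withDensity (fun x => ENNReal.ofReal (p x))
  ordConnected_support : (Function.support p).OrdConnected
  differentiableOn : DifferentiableOn ℝ p (interior (Function.support p))

/-- The Stein kernel `τ(x) = (∫_x^∞ (y - m) p(y) dy) / p(x)` of a density `p` with mean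
`m = ∫ z p(z) dz`. Only its values on the support of `p` matter. -/
def steinKernel (p : ℝ → ℝ) (x : ℝ) : ℝ :=
  (∫ y in Set.Ioi x, (y - ∫ z, z * p z) * p y) / p x

/-- `p` is an absolutely continuous density of the law `ν`, and `q` is a (Radon–Nikodym)
derivative of `p`. -/
structure IsACDensity (ν : Measure ℝ) (p q : ℝ → ℝ) : Prop where
  nonneg : ∀ x, 0 ≤ p x
  eq_withDensity : ν = volume.withDensity (fun x => ENNReal.ofReal (p x))
  intervalIntegrable : ∀ a b : ℝ, IntervalIntegrable q volume a b
  integral_eq : ∀ a b : ℝ, ∫ x in a..b, q x = p b - p a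

/-- The Fisher information distance `I(F‖Z) = E[(ρ_F(F) + (F - m) / v)²]`, `ρ_F = p_F' / p_F`, of the
random variable `F` to `Z ∼ N(m, v)`, where `m` and `v` are to be the mean and the variance of `F`.
The pair `(p_F, p_F')` is unique up to null sets, so that the infimum runs over equal numbers; it is
`∞` exactly when the law of `F` has no absolutely continuous density or the expectation is `∞`. -/
def fisherDist {Ω : Type*} [MeasurableSpace Ω] (P : Measure Ω) (F : Ω → ℝ) (m v : ℝ) : ℝ≥0∞ :=
  ⨅ (p : ℝ → ℝ) (q : ℝ → ℝ) (_ : IsACDensity (P.map F) p q),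
    ∫⁻ ω, ENNReal.ofReal ((q (F ω) / p (F ω) + (F ω - m) / v) ^ 2) ∂P

/-- `E|Y|⁸` in `[0, ∞]`. -/
def moment8 {Ω : Type*} [MeasurableSpace Ω] (P : Measure Ω) (Y : Ω → ℝ) : ℝ≥0∞ :=
  ∫⁻ ω, ‖Y ω‖ₑ ^ 8 ∂P

/-- The negative moment `E|Y|⁻⁸` in `[0, ∞]`, where `|Y|⁻⁸ = ∞` on the event `Y = 0`. -/
def negMoment8 {Ω : Type*} [MeasurableSpace Ω] (P : Measure Ω) (Y : Ω → ℝ) : ℝ≥0∞ :=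
  ∫⁻ ω, (‖Y ω‖ₑ ^ 8)⁻¹ ∂P

/-- `‖Y⁻¹‖₈ = (E|Y|⁻⁸)^(1/8)` in `[0, ∞]`. -/
def invNorm8 {Ω : Type*} [MeasurableSpace Ω] (P : Measure Ω) (Y : Ω → ℝ) : ℝ≥0∞ :=
  negMoment8 P Y ^ (1 / 8 : ℝ)

/- The sequence `X₁, X₂, …` is indexed from zero: `X k` below stands for `X_{k+1}`, and `p k` for its
density. -/

/-- The sample mean `(X₁ + ⋯ + Xₙ) / n`. -/
def sampleMean {Ω : Type*} (X : ℕ → Ω → ℝ) (n : ℕ) (ω : Ω) : ℝ :=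
  (∑ k ∈ Finset.range n, X k ω) / n

/-- The sum `τ₁(X₁) + ⋯ + τₙ(Xₙ)`. -/
def steinSum {Ω : Type*} (X : ℕ → Ω → ℝ) (p : ℕ → ℝ → ℝ) (n : ℕ) (ω : Ω) : ℝ :=
  ∑ k ∈ Finset.range n, steinKernel (p k) (X k ω)

/-- The statistic `Fₙ = √n (H(X̄) - E[H(X̄)])`. -/
def meanStat {Ω : Type*} [MeasurableSpace Ω] (P : Measure Ω) (H : ℝ → ℝ) (X : ℕ → Ω → ℝ)
    (n : ℕ) (ω : Ω) : ℝ :=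
  √(n : ℝ) * (H (sampleMean X n ω) - ∫ ω', H (sampleMean X n ω') ∂P)

/-- `∇_{Fₙ} = (H'(0) H'(X̄) / n) (τ₁(X₁) + ⋯ + τₙ(Xₙ))`. -/
def nablaStat {Ω : Type*} (H : ℝ → ℝ) (X : ℕ → Ω → ℝ) (p : ℕ → ℝ → ℝ) (n : ℕ) (ω : Ω) : ℝ :=
  deriv H 0 * deriv H (sampleMean X n ω) / n * steinSum X p n ω

/-- `β`, the maximum of the suprema over `k` of `E|X_k|⁸`, `E|τ_k(X_k)|⁸` and `E|τ_k'(X_k)|⁸`. -/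
def betaConst {Ω : Type*} [MeasurableSpace Ω] (P : Measure Ω) (X : ℕ → Ω → ℝ)
    (p : ℕ → ℝ → ℝ) : ℝ≥0∞ :=
  max (⨆ k, moment8 P (X k))
    (max (⨆ k, moment8 P (fun ω => steinKernel (p k) (X k ω)))
      (⨆ k, moment8 P (fun ω => deriv (steinKernel (p k)) (X k ω))))

/-- `γ`, the supremum of `‖∇_{Fₙ}⁻¹‖₈` over `n ≥ n₀`. -/
def gammaConst {Ω : Type*} [MeasurableSpace Ω] (P : Measure Ω) (H : ℝ → ℝ) (X : ℕ → Ω → ℝ)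
    (p : ℕ → ℝ → ℝ) (n₀ : ℕ) : ℝ≥0∞ :=
  ⨆ (n : ℕ) (_ : n₀ ≤ n), invNorm8 P (nablaStat H X p n)

/-- The supremum norm of a bounded function on the real line. -/
def supNorm (f : ℝ → ℝ) : ℝ := ⨆ x, |f x|

end

/-! If F has density p and a weight G satisfies E[φ'(F)] = E[φ(F) G] for enough functions φ, then
p'/p at F equals -E[G | F]. Hence I(F‖Z) = E[(F - E[G | F])²] ≤ E[(F - G)²], because conditional
expectation contracts L². It therefore suffices to produce an explicit G that is close to F in L².

The Stein kernel gives E[τ(X)ψ'(X)] = E[Xψ(X)] for a single variable. Write S for the sum of the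
X_k, T for the sum of the τ_k(X_k) and Q for the sum of the τ_k(X_k)τ_k'(X_k). Applying the identity
in each variable to u(S)/T, with the others frozen, and adding up gives E[u'(S)] = E[u(S)(S/T +
Q/T²)] (`integral_deriv_eq`); T is replaced by T + ε at first, since it may be near 0. For F = f(S),
the choice u = φ(f)/f' yields G = (S/T + Q/T²)/f'(S) + f''(S)/f'(S)² (`steinWeight`). Only ramps φ
are needed: they give the density of F and its derivative (`fisherDist_le_of_integral_eq`).

For f(s) = σ⁻¹√n(H(s/n) - m), m = E[H(X̄)], both F and the main term of G are approximately
σ⁻¹H'(0)S/√n, because T ≈ n, H'(X̄) ≈ H'(0) and σ² ≈ H'(0)², each with relative error of order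
n^(-1/2). The remaining terms have the same order, so E[(F - G)²] = O(1/n) (`sq_stein_error_le`).
The moments come from an O(n⁴) bound on the eighth moment of centered sums, applied to S and T - n,
and from the negative moment of ∇. The latter is uniform in n: the first n₀ kernels keep T⁻⁸
integrable, and a Chernoff bound for the others makes T of order n (`exists_negMoment8_sum_le`). The
lower bound on |H'| is used only qualitatively, so the constant depends on it only through γ. -/

section

open Set Filter Topology

/-! ### Interval densities -/

lemma countable_frontier_of_ordConnected {s : Set ℝ} (hs : s.OrdConnected) :
    (frontier s).Countable := by
  have key : ∀ a b : ℝ, ({a, b} : Set ℝ).Countable := fun a b => (Set.toFinite _).countable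
  -- This is the list of the ten shapes of an interval; in each one the frontier lies in {inf, sup}.
  have h := (isPreconnected_iff_ordConnected.2 hs).mem_intervals
  simp only [Set.mem_insert_iff, Set.mem_singleton_iff] at h
  refine (key (sInf s) (sSup s)).mono ?_
  generalize sInf s = a at *
  generalize sSup s = b at *
  rcases h with h | h | h | h | h | h | h | h | h | h <;> subst h
  · rcases le_or_gt a b with hab | hab
    · rw [frontier_Icc hab]
    · simp [Set.Icc_eq_empty (not_le.2 hab)]
  · rcases lt_or_ge a b with hab | hab
    · rw [frontier_Ico hab]
    · simp [Set.Ico_eq_empty (not_lt.2 hab)]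
  · rcases lt_or_ge a b with hab | hab
    · rw [frontier_Ioc hab]
    · simp [Set.Ioc_eq_empty (not_lt.2 hab)]
  · rcases lt_or_ge a b with hab | hab
    · rw [frontier_Ioo hab]
    · simp [Set.Ioo_eq_empty (not_lt.2 hab)]
  all_goals simp

namespace IsIntervalDensity

variable {ν : Measure ℝ} {p : ℝ → ℝ}

lemma continuousOn (h : IsIntervalDensity ν p) :
    ContinuousOn p (interior (Function.support p)) :=
  h.differentiableOn.continuousOn

/-- Nothing is assumed about the density at the endpoints of its support, but it is continuous in
the interior, zero off the support, and the frontier is countable. -/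
lemma measurable (h : IsIntervalDensity ν p) : Measurable p := by
  have h1 : Measurable ((interior (Function.support p)).indicator p) := by
    refine measurable_of_restrict_of_restrict_compl (s := interior (Function.support p))
      isOpen_interior.measurableSet ?_ ?_
    · have := (continuousOn_iff_continuous_domRestrict.1 h.continuousOn).measurable
      convert this using 1
      ext x
      simp [x.2]
    · have : (interior (Function.support p))ᶜ.domRestrict
          ((interior (Function.support p)).indicator p) = fun _ => 0 := by
        ext x
        simpa [Set.domRestrict] using fun hx => absurd hx x.2
      rw [this]
      exact measurable_const
  refine h1.measurable_of_countable_ne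
    ((countable_frontier_of_ordConnected h.ordConnected_support).mono ?_)
  intro x hx
  simp only [Set.mem_ofPred_eq] at hx
  by_cases hxi : x ∈ interior (Function.support p)
  · simp [hxi] at hx
  · refine ⟨subset_closure ?_, hxi⟩
    simp only [hxi, not_false_eq_true, Set.indicator_of_notMem, ne_eq] at hx
    exact fun h0 => hx h0.symm

lemma ae_volume_notMem (h : IsIntervalDensity ν p) :
    ∀ᵐ x, x ∉ interior (Function.support p) → p x = 0 := by
  filter_upwards [(countable_frontier_of_ordConnected h.ordConnected_support).ae_notMem volume]
    with x hx hxi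
  by_contra h0
  exact hx ⟨subset_closure h0, hxi⟩

lemma integral_eq (h : IsIntervalDensity ν p) (g : ℝ → ℝ) :
    ∫ x, g x ∂ν = ∫ x, p x * g x := by
  rw [h.eq_withDensity, integral_withDensity_eq_integral_toReal_smul h.measurable.ennreal_ofReal
    (by simp)]
  simp [ENNReal.toReal_ofReal (h.nonneg _)]

lemma integrable_iff (h : IsIntervalDensity ν p) (g : ℝ → ℝ) :
    Integrable g ν ↔ Integrable (fun x => p x * g x) := by
  rw [h.eq_withDensity, integrable_withDensity_iff_integrable_smul' h.measurable.ennreal_ofReal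
    (by simp)]
  simp [ENNReal.toReal_ofReal (h.nonneg _)]

lemma pos (h : IsIntervalDensity ν p) {x : ℝ} (hx : x ∈ interior (Function.support p)) :
    0 < p x :=
  lt_of_le_of_ne (h.nonneg x) (Ne.symm (interior_subset hx))

end IsIntervalDensity

/-- The numerator `∫_x^∞ y p(y) dy` of the Stein kernel of a centered density. -/
noncomputable def tailMean (p : ℝ → ℝ) (x : ℝ) : ℝ := ∫ y in Set.Ioi x, y * p y

/-- An interval density of a centered law with finite first moment. -/
structure IsCenteredDensity (ν : Measure ℝ) (p : ℝ → ℝ) : Prop extends IsIntervalDensity ν p where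
  integrable_id : Integrable (fun x : ℝ => x) ν
  integral_id : ∫ x, x ∂ν = 0

/-! ### The Stein kernel of a centered density. -/

namespace IsCenteredDensity

variable {ν : Measure ℝ} {p : ℝ → ℝ}

lemma integrable_mul (h : IsCenteredDensity ν p) : Integrable (fun y => y * p y) := by
  simpa [mul_comm] using (h.integrable_iff _).1 h.integrable_id

lemma integral_mul (h : IsCenteredDensity ν p) : ∫ y, y * p y = 0 := by
  have := h.integral_eq (fun x => x)
  rw [h.integral_id] at this
  simpa [mul_comm] using this.symm

lemma steinKernel_eq (h : IsCenteredDensity ν p) (x : ℝ) :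
    steinKernel p x = tailMean p x / p x := by
  simp [steinKernel, tailMean, h.integral_mul]

lemma tailMean_eq_neg (h : IsCenteredDensity ν p) (x : ℝ) :
    tailMean p x = - ∫ y in Set.Iic x, y * p y := by
  have := intervalIntegral.integral_Iic_add_Ioi (b := x) h.integrable_mul.integrableOn
    h.integrable_mul.integrableOn
  rw [h.integral_mul] at this
  unfold tailMean
  linarith

lemma tailMean_sub (h : IsCenteredDensity ν p) (x y : ℝ) :
    tailMean p y = tailMean p x - ∫ z in x..y, z * p z := by
  rw [h.tailMean_eq_neg, h.tailMean_eq_neg, ← intervalIntegral.integral_Iic_sub_Iic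
    h.integrable_mul.integrableOn h.integrable_mul.integrableOn]
  ring

lemma continuous_tailMean (h : IsCenteredDensity ν p) : Continuous (tailMean p) := by
  have : tailMean p = fun y => tailMean p 0 - ∫ z in (0 : ℝ)..y, z * p z :=
    funext fun y => h.tailMean_sub 0 y
  rw [this]
  exact continuous_const.sub (intervalIntegral.continuous_primitive
    (fun a b => h.integrable_mul.intervalIntegrable) 0)

/-- The integrand has constant sign on (x, ∞) if x ≥ 0 and on (-∞, x] if x ≤ 0, and centering lets
either half-line be used. -/
lemma tailMean_nonneg (h : IsCenteredDensity ν p) (x : ℝ) : 0 ≤ tailMean p x := by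
  rcases le_total 0 x with hx | hx
  · exact setIntegral_nonneg measurableSet_Ioi fun y hy =>
      mul_nonneg (hx.trans (le_of_lt hy)) (h.nonneg y)
  · rw [h.tailMean_eq_neg, neg_nonneg]
    exact setIntegral_nonpos measurableSet_Iic fun y hy =>
      mul_nonpos_of_nonpos_of_nonneg (le_trans hy hx) (h.nonneg y)

lemma steinKernel_nonneg (h : IsCenteredDensity ν p) (x : ℝ) : 0 ≤ steinKernel p x := by
  rw [h.steinKernel_eq]; exact div_nonneg (h.tailMean_nonneg x) (h.nonneg x)

/-- A point outside the open interval of positivity has all the mass on one side, so the tail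
integral is either empty or the full mean, which is 0. -/
lemma tailMean_eq_zero (h : IsCenteredDensity ν p) {x : ℝ}
    (hx : x ∉ interior (Function.support p)) : tailMean p x = 0 := by
  have hJ : (interior (Function.support p)).OrdConnected := h.ordConnected_support.interior
  by_cases hL : ∃ a ∈ interior (Function.support p), a < x
  · obtain ⟨a, ha, hax⟩ := hL
    unfold tailMean
    refine (setIntegral_congr_ae (g := fun _ => 0) measurableSet_Ioi ?_).trans (by simp)
    filter_upwards [h.ae_volume_notMem] with y hy hxy
    rw [hy fun hyJ => hx (hJ.out ha hyJ ⟨hax.le, le_of_lt hxy⟩), mul_zero]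
  · rw [h.tailMean_eq_neg, neg_eq_zero]
    refine (setIntegral_congr_ae (g := fun _ => 0) measurableSet_Iic ?_).trans (by simp)
    filter_upwards [h.ae_volume_notMem] with y hy hxy
    rw [hy fun hyJ => ?_, mul_zero]
    rcases lt_or_eq_of_le (show y ≤ x from hxy) with h1 | h1
    · exact hL ⟨y, hyJ, h1⟩
    · exact hx (h1 ▸ hyJ)

lemma mul_steinKernel (h : IsCenteredDensity ν p) {x : ℝ}
    (hx : x ∈ interior (Function.support p)) : p x * steinKernel p x = tailMean p x := by
  rw [h.steinKernel_eq, mul_div_cancel₀ _ (h.pos hx).ne']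

lemma hasDerivAt_tailMean (h : IsCenteredDensity ν p) {x : ℝ}
    (hx : x ∈ interior (Function.support p)) : HasDerivAt (tailMean p) (-(x * p x)) x := by
  have e : tailMean p = fun y => tailMean p x - ∫ z in x..y, z * p z :=
    funext fun y => h.tailMean_sub x y
  rw [e, ← zero_sub]
  refine (hasDerivAt_const x _).sub ?_
  refine intervalIntegral.integral_hasDerivAt_right h.integrable_mul.intervalIntegrable
    (measurable_id.mul h.measurable).stronglyMeasurable.stronglyMeasurableAtFilter ?_
  exact continuousAt_id.mul (h.continuousOn.continuousAt (isOpen_interior.mem_nhds hx))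

lemma differentiableAt_steinKernel (h : IsCenteredDensity ν p) {x : ℝ}
    (hx : x ∈ interior (Function.support p)) : DifferentiableAt ℝ (steinKernel p) x := by
  have e : steinKernel p = fun x => tailMean p x / p x := funext h.steinKernel_eq
  rw [e]
  exact (h.hasDerivAt_tailMean hx).differentiableAt.div
    (h.differentiableOn.differentiableAt (isOpen_interior.mem_nhds hx)) (h.pos hx).ne'

lemma measurable_steinKernel (h : IsCenteredDensity ν p) : Measurable (steinKernel p) := by
  have e : steinKernel p = fun x => tailMean p x / p x := funext h.steinKernel_eq
  rw [e]
  exact h.continuous_tailMean.measurable.div h.measurable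

lemma tendsto_tailMean_atTop (p : ℝ → ℝ) :
    Tendsto (fun n : ℕ => tailMean p n) atTop (𝓝 0) :=
  tendsto_integral_Ioi_zero tendsto_natCast_atTop_atTop

lemma tendsto_tailMean_atBot (h : IsCenteredDensity ν p) :
    Tendsto (fun n : ℕ => tailMean p (-n)) atTop (𝓝 0) := by
  simp_rw [h.tailMean_eq_neg]
  rw [← neg_zero]
  refine Tendsto.neg ?_
  exact tendsto_integral_Iic_zero (tendsto_neg_atTop_atBot.comp tendsto_natCast_atTop_atTop)

/-- Stein's integration by parts for a bounded test function that is differentiable, off a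
countable set, on the interval of positivity of the density. -/
theorem integral_steinKernel_mul (h : IsCenteredDensity ν p) {ψ ψ' : ℝ → ℝ} {D : Set ℝ} {M : ℝ}
    (hD : D.Countable) (hM : ∀ x, |ψ x| ≤ M) (hm : Measurable ψ)
    (hc : ContinuousOn ψ (interior (Function.support p)))
    (hd : ∀ x ∈ interior (Function.support p) \ D, HasDerivAt ψ (ψ' x) x)
    (hi : Integrable (fun x => steinKernel p x * ψ' x) ν) :
    ∫ x, steinKernel p x * ψ' x ∂ν = ∫ x, x * ψ x ∂ν := by
  set J := interior (Function.support p) with hJ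
  -- The product is continuous on the whole line even where ψ is not, since its first factor
  -- vanishes off `J` and ψ is bounded. Hence no boundary terms arise at the endpoints of `J`, and
  -- the fundamental theorem of calculus applies with a countable exceptional set.
  set f : ℝ → ℝ := fun x => tailMean p x * ψ x with hf
  set f' : ℝ → ℝ := J.indicator
    fun x => p x * (steinKernel p x * ψ' x) - p x * (x * ψ x) with hf'
  have hi2 : Integrable (fun x => x * ψ x) ν := by
    refine (h.integrable_id.norm.const_mul M).mono'
      (measurable_id.mul hm).aestronglyMeasurable (ae_of_all _ fun x => ?_)
    rw [norm_mul, mul_comm]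
    exact mul_le_mul_of_nonneg_right (hM x) (norm_nonneg _)
  have I1 := (h.integrable_iff _).1 hi
  have I2 := (h.integrable_iff _).1 hi2
  have hfi : Integrable f' := (I1.sub I2).indicator isOpen_interior.measurableSet
  have hcont : Continuous f := by
    rw [continuous_iff_continuousAt]
    intro x
    by_cases hx : x ∈ J
    · exact h.continuous_tailMean.continuousAt.mul (hc.continuousAt (isOpen_interior.mem_nhds hx))
    · have hN : tailMean p x = 0 := h.tailMean_eq_zero hx
      have : Tendsto (fun y => |tailMean p y| * M) (𝓝 x) (𝓝 0) := by
        have := (h.continuous_tailMean.abs.mul_const M).tendsto x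
        simpa [hN] using this
      show Tendsto f (𝓝 x) (𝓝 (f x))
      have e : f x = 0 := by simp [hf, hN]
      rw [e]
      refine squeeze_zero_norm (fun y => ?_) this
      rw [hf, norm_mul]
      exact mul_le_mul_of_nonneg_left (hM y) (norm_nonneg _)
  have hder : ∀ x, x ∉ frontier J ∪ D → HasDerivAt f (f' x) x := by
    intro x hx
    simp only [Set.mem_union, not_or] at hx
    by_cases hxJ : x ∈ J
    · have := (h.hasDerivAt_tailMean hxJ).mul (hd x ⟨hxJ, hx.2⟩)
      refine this.congr_deriv ?_
      rw [hf', Set.indicator_of_mem hxJ, ← mul_assoc, h.mul_steinKernel hxJ]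
      ring
    · have hxc : x ∉ closure J := fun hcl => hx.1 ⟨hcl, by rwa [hJ, interior_interior]⟩
      have e : f =ᶠ[𝓝 x] fun _ => 0 := by
        filter_upwards [isClosed_closure.isOpen_compl.mem_nhds hxc] with y hy
        have : y ∉ J := fun h' => hy (subset_closure h')
        simp [hf, h.tailMean_eq_zero this]
      rw [hf', Set.indicator_of_notMem hxJ]
      exact (hasDerivAt_const x (0 : ℝ)).congr_of_eventuallyEq e
  have hcount : (frontier J ∪ D).Countable :=
    (countable_frontier_of_ordConnected h.ordConnected_support.interior).union hD
  have hFTC : ∀ n : ℕ, ∫ x in (-(n : ℝ))..n, f' x = f n - f (-n) := fun n =>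
    integral_eq_of_hasDerivAt_off_countable f f' hcount hcont.continuousOn
      (fun x hx => hder x hx.2) hfi.intervalIntegrable
  have L1 : Tendsto (fun n : ℕ => ∫ x in (-(n : ℝ))..n, f' x) atTop (𝓝 (∫ x, f' x)) :=
    intervalIntegral_tendsto_integral hfi
      (tendsto_neg_atTop_atBot.comp tendsto_natCast_atTop_atTop) tendsto_natCast_atTop_atTop
  have aux : ∀ a : ℕ → ℝ, Tendsto (fun n => tailMean p (a n)) atTop (𝓝 0) →
      Tendsto (fun n => f (a n)) atTop (𝓝 0) := by
    intro a ha
    have := (ha.abs.mul_const M)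
    simp only [abs_zero, zero_mul] at this
    refine squeeze_zero_norm (fun n => ?_) this
    rw [hf, norm_mul]
    exact mul_le_mul_of_nonneg_left (hM _) (norm_nonneg _)
  have L2 : Tendsto (fun n : ℕ => f n - f (-n)) atTop (𝓝 0) := by
    simpa using (aux _ (tendsto_tailMean_atTop p)).sub (aux _ h.tendsto_tailMean_atBot)
  simp_rw [hFTC] at L1
  have h0 := tendsto_nhds_unique L1 L2
  have e : ∫ x, f' x = ∫ x, (p x * (steinKernel p x * ψ' x) - p x * (x * ψ x)) := by
    refine integral_congr_ae ?_
    filter_upwards [h.ae_volume_notMem] with x hx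
    by_cases hxJ : x ∈ J
    · simp [hf', hxJ]
    · simp [hf', hxJ, hx hxJ]
  rw [e, integral_sub I1 I2, ← h.integral_eq, ← h.integral_eq] at h0
  linarith

/-- The mean of the Stein kernel is the variance. -/
theorem integral_steinKernel (h : IsCenteredDensity ν p)
    (hτ : Integrable (steinKernel p) ν) (h2 : Integrable (fun x : ℝ => x ^ 2) ν) :
    ∫ x, steinKernel p x ∂ν = ∫ x, x ^ 2 ∂ν := by
  -- The identity function is not a bounded test function. It is approximated by (n+1) sin(x/(n+1)),
  -- which is bounded, dominated by |x|, and has derivative cos(x/(n+1)) → 1.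
  have key : ∀ n : ℕ, ∫ x, steinKernel p x * Real.cos (x / (n + 1)) ∂ν
      = ∫ x, x * ((n + 1) * Real.sin (x / (n + 1))) ∂ν := by
    intro n
    have hn : (0 : ℝ) < n + 1 := by positivity
    refine h.integral_steinKernel_mul (D := ∅) (M := n + 1) Set.countable_empty ?_ (by fun_prop)
      (by fun_prop) ?_ ?_
    · intro x
      rw [abs_mul, abs_of_pos hn]
      exact mul_le_of_le_one_right hn.le (Real.abs_sin_le_one _)
    · intro x _
      have := (((hasDerivAt_id x).div_const ((n : ℝ) + 1)).sin).const_mul ((n : ℝ) + 1)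
      refine this.congr_deriv ?_
      rw [id]
      field_simp
    · refine hτ.mono' (h.measurable_steinKernel.mul (by fun_prop)).aestronglyMeasurable
        (ae_of_all _ fun x => ?_)
      rw [norm_mul, Real.norm_of_nonneg (h.steinKernel_nonneg x)]
      exact mul_le_of_le_one_right (h.steinKernel_nonneg x) (Real.abs_cos_le_one _)
  have hlim : ∀ x : ℝ, Tendsto (fun n : ℕ => x / ((n : ℝ) + 1)) atTop (𝓝 0) := fun x =>
    (tendsto_const_nhds.div_atTop (tendsto_atTop_add_const_right _ _ tendsto_natCast_atTop_atTop))
  have L1 : Tendsto (fun n : ℕ => ∫ x, steinKernel p x * Real.cos (x / (n + 1)) ∂ν) atTop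
      (𝓝 (∫ x, steinKernel p x ∂ν)) := by
    refine tendsto_integral_of_dominated_convergence (steinKernel p)
      (fun n => (h.measurable_steinKernel.mul (by fun_prop)).aestronglyMeasurable) hτ
      (fun n => ae_of_all _ fun x => ?_) (ae_of_all _ fun x => ?_)
    · rw [norm_mul, Real.norm_of_nonneg (h.steinKernel_nonneg x)]
      exact mul_le_of_le_one_right (h.steinKernel_nonneg x) (Real.abs_cos_le_one _)
    · have := ((Real.continuous_cos.tendsto 0).comp (hlim x)).const_mul (steinKernel p x)
      simpa using this
  have L2 : Tendsto (fun n : ℕ => ∫ x, x * ((n + 1) * Real.sin (x / (n + 1))) ∂ν) atTop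
      (𝓝 (∫ x, x ^ 2 ∂ν)) := by
    refine tendsto_integral_of_dominated_convergence (fun x => x ^ 2)
      (fun n => by fun_prop) h2 (fun n => ae_of_all _ fun x => ?_) (ae_of_all _ fun x => ?_)
    · have hn : (0 : ℝ) < n + 1 := by positivity
      have h1 : |Real.sin (x / (n + 1))| ≤ |x / (n + 1)| := Real.abs_sin_le_abs
      rw [abs_div, abs_of_pos hn, le_div_iff₀ hn] at h1
      rw [norm_mul, norm_mul, Real.norm_of_nonneg hn.le, Real.norm_eq_abs, Real.norm_eq_abs,
        ← sq_abs x, sq]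
      exact mul_le_mul_of_nonneg_left (by linarith) (abs_nonneg x)
    · have hd := (Real.hasDerivAt_sin 0).tendsto_slope
      by_cases hx : x = 0
      · simp [hx]
      have h1 : Tendsto (fun n : ℕ => x / ((n : ℝ) + 1)) atTop (𝓝[≠] 0) := by
        refine tendsto_nhdsWithin_iff.2 ⟨hlim x, Eventually.of_forall fun n => ?_⟩
        exact div_ne_zero hx (by positivity)
      have h2 := ((hd.comp h1).const_mul (x ^ 2))
      rw [Real.cos_zero, mul_one] at h2
      refine h2.congr fun n => ?_
      have hn : ((n : ℝ) + 1) ≠ 0 := by positivity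
      simp only [Function.comp, slope_def_field, Real.sin_zero, sub_zero]
      field_simp
  simp_rw [key] at L1
  exact tendsto_nhds_unique L1 L2

end IsCenteredDensity

/-! ### Integration by parts for sums of independent variables -/

section Independent

variable {Ω : Type*} [MeasurableSpace Ω] {P : Measure Ω} [IsProbabilityMeasure P]

/-- Fubini for the product law: by independence an identity may be checked with the second variable
frozen. -/
lemma integral_eq_of_indepFun_of_ae {𝓨 : Type*} [MeasurableSpace 𝓨] {X : Ω → ℝ} {Y : Ω → 𝓨}
    (hX : Measurable X) (hY : Measurable Y) (hXY : IndepFun X Y P) {g₁ g₂ : ℝ × 𝓨 → ℝ}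
    (hg₁ : Measurable g₁) (hg₂ : Measurable g₂)
    (hi₁ : Integrable (fun ω => g₁ (X ω, Y ω)) P) (hi₂ : Integrable (fun ω => g₂ (X ω, Y ω)) P)
    (h : ∀ᵐ ω ∂P, ∫ x, g₁ (x, Y ω) ∂(P.map X) = ∫ x, g₂ (x, Y ω) ∂(P.map X)) :
    ∫ ω, g₁ (X ω, Y ω) ∂P = ∫ ω, g₂ (X ω, Y ω) ∂P := by
  have hmap := hXY.map_prod_eq_prod_map_map hX.aemeasurable hY.aemeasurable
  have key : ∀ g : ℝ × 𝓨 → ℝ, Measurable g → Integrable (fun ω => g (X ω, Y ω)) P →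
      ∫ ω, g (X ω, Y ω) ∂P = ∫ ω, ∫ x, g (x, Y ω) ∂(P.map X) ∂P := by
    intro g hg hi
    have := Measure.isProbabilityMeasure_map (μ := P) hX.aemeasurable
    have := Measure.isProbabilityMeasure_map (μ := P) hY.aemeasurable
    have hi' : Integrable g ((P.map X).prod (P.map Y)) := by
      rw [← hmap]
      exact (integrable_map_measure hg.aestronglyMeasurable (hX.prodMk hY).aemeasurable).2 hi
    rw [← integral_map (φ := fun ω => (X ω, Y ω)) (f := g) (hX.prodMk hY).aemeasurable
      hg.aestronglyMeasurable, hmap, integral_prod_symm g hi',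
      integral_map hY.aemeasurable]
    exact (StronglyMeasurable.integral_prod_right (f := fun y x => g (x, y))
      (hg.comp measurable_swap).stronglyMeasurable).aestronglyMeasurable
  rw [key g₁ hg₁ hi₁, key g₂ hg₂ hi₂]
  exact integral_congr_ae h

/-- A bounded continuous test function with a bounded derivative off a countable set. -/
structure IsTestFunction (u u' : ℝ → ℝ) (M : ℝ) : Prop where
  continuous : Continuous u
  measurable : Measurable u'
  bound : ∀ x, |u x| ≤ M
  bound' : ∀ x, |u' x| ≤ M
  hasDerivAt : ∃ D : Set ℝ, D.Countable ∧ ∀ x, x ∉ D → HasDerivAt u (u' x) x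

lemma IsTestFunction.nonneg {u u' : ℝ → ℝ} {M : ℝ} (h : IsTestFunction u u' M) : 0 ≤ M :=
  (abs_nonneg _).trans (h.bound 0)

/-- Integration by parts with respect to one of the variables of `u(x + s) / (τ(x) + t + ε)`. -/
lemma integral_mul_div_steinKernel {X : Ω → ℝ} {Y : Ω → ℝ × ℝ} {p u u' : ℝ → ℝ} {M ε : ℝ}
    (hX : Measurable X) (hY : Measurable Y) (hXY : IndepFun X Y P)
    (hp : IsCenteredDensity (P.map X) p) (hY0 : ∀ ω, 0 ≤ (Y ω).2)
    (hτ : Integrable (fun ω => steinKernel p (X ω)) P)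
    (hττ : Integrable (fun ω => steinKernel p (X ω) * deriv (steinKernel p) (X ω)) P)
    (hu : IsTestFunction u u' M) (hε : 0 < ε) :
    Integrable (fun ω => X ω * (u (X ω + (Y ω).1) / (steinKernel p (X ω) + (Y ω).2 + ε))) P ∧
    Integrable (fun ω => steinKernel p (X ω) *
      (u' (X ω + (Y ω).1) / (steinKernel p (X ω) + (Y ω).2 + ε) -
        deriv (steinKernel p) (X ω) * u (X ω + (Y ω).1) /
          (steinKernel p (X ω) + (Y ω).2 + ε) ^ 2)) P ∧
    ∫ ω, X ω * (u (X ω + (Y ω).1) / (steinKernel p (X ω) + (Y ω).2 + ε)) ∂P =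
      ∫ ω, steinKernel p (X ω) * (u' (X ω + (Y ω).1) / (steinKernel p (X ω) + (Y ω).2 + ε) -
        deriv (steinKernel p) (X ω) * u (X ω + (Y ω).1) /
          (steinKernel p (X ω) + (Y ω).2 + ε) ^ 2) ∂P := by
  have hM := hu.nonneg
  have hmτ := hp.measurable_steinKernel
  have hmτ' : Measurable (deriv (steinKernel p)) := measurable_deriv _
  have hmu := hu.continuous.measurable
  have hmu' := hu.measurable
  set τ := steinKernel p with hτdef
  have hτ0 : ∀ x, 0 ≤ τ x := hp.steinKernel_nonneg
  -- The kernels are nonnegative, so ε alone bounds the denominator below. This makes the test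
  -- function bounded and gives a domination `b2` uniform in the frozen pair (s, t).
  have hden : ∀ x t, 0 ≤ t → ε ≤ τ x + t + ε := fun x t ht => by linarith [hτ0 x]
  have b1 : ∀ x s t, 0 ≤ t → |u (x + s) / (τ x + t + ε)| ≤ M / ε := by
    intro x s t ht
    rw [abs_div, abs_of_pos (hε.trans_le (hden x t ht))]
    exact div_le_div₀ hM (hu.bound _) hε (hden x t ht)
  have b2 : ∀ x s t, 0 ≤ t → |τ x * (u' (x + s) / (τ x + t + ε) -
      deriv τ x * u (x + s) / (τ x + t + ε) ^ 2)| ≤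
        M / ε * τ x + M / ε ^ 2 * |τ x * deriv τ x| := by
    intro x s t ht
    have h0 := hε.trans_le (hden x t ht)
    have e1 : |u' (x + s) / (τ x + t + ε)| ≤ M / ε := by
      rw [abs_div, abs_of_pos h0]
      exact div_le_div₀ hM (hu.bound' _) hε (hden x t ht)
    have e2 : |u (x + s) / (τ x + t + ε) ^ 2| ≤ M / ε ^ 2 := by
      rw [abs_div, abs_of_pos (pow_pos h0 2)]
      exact div_le_div₀ hM (hu.bound _) (pow_pos hε 2) (pow_le_pow_left₀ hε.le (hden x t ht) 2)
    calc |τ x * (u' (x + s) / (τ x + t + ε) - deriv τ x * u (x + s) / (τ x + t + ε) ^ 2)|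
        = |(u' (x + s) / (τ x + t + ε)) * τ x -
            (u (x + s) / (τ x + t + ε) ^ 2) * (τ x * deriv τ x)| := by congr 1; ring
      _ ≤ |(u' (x + s) / (τ x + t + ε)) * τ x| +
            |(u (x + s) / (τ x + t + ε) ^ 2) * (τ x * deriv τ x)| := abs_sub _ _
      _ ≤ _ := by
        rw [abs_mul, abs_mul, abs_of_nonneg (hτ0 x)]
        exact add_le_add (mul_le_mul_of_nonneg_right e1 (hτ0 x))
          (mul_le_mul_of_nonneg_right e2 (abs_nonneg _))
  let g₁ : ℝ × (ℝ × ℝ) → ℝ := fun z => z.1 * (u (z.1 + z.2.1) / (τ z.1 + z.2.2 + ε))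
  let g₂ : ℝ × (ℝ × ℝ) → ℝ := fun z => τ z.1 * (u' (z.1 + z.2.1) / (τ z.1 + z.2.2 + ε) -
    deriv τ z.1 * u (z.1 + z.2.1) / (τ z.1 + z.2.2 + ε) ^ 2)
  have hg₁ : Measurable g₁ := by fun_prop
  have hg₂ : Measurable g₂ := by fun_prop
  have hXi : Integrable X P :=
    (integrable_map_measure (by fun_prop) hX.aemeasurable).1 hp.integrable_id
  have hi₁ : Integrable (fun ω => g₁ (X ω, Y ω)) P := by
    refine (hXi.norm.const_mul (M / ε)).mono'
      (hg₁.comp (hX.prodMk hY)).aestronglyMeasurable (ae_of_all _ fun ω => ?_)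
    simp only [g₁]
    rw [norm_mul, mul_comm]
    exact mul_le_mul_of_nonneg_right (b1 _ _ _ (hY0 ω)) (norm_nonneg _)
  have hi₂ : Integrable (fun ω => g₂ (X ω, Y ω)) P := by
    refine ((hτ.const_mul (M / ε)).add (hττ.norm.const_mul (M / ε ^ 2))).mono'
      (hg₂.comp (hX.prodMk hY)).aestronglyMeasurable (ae_of_all _ fun ω => ?_)
    exact b2 _ _ _ (hY0 ω)
  refine ⟨hi₁, hi₂, integral_eq_of_indepFun_of_ae hX hY hXY hg₁ hg₂ hi₁ hi₂
    (ae_of_all _ fun ω => ?_)⟩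
  obtain ⟨D, hD, hDd⟩ := hu.hasDerivAt
  have ht := hY0 ω
  generalize Y ω = y at ht ⊢
  obtain ⟨s, t⟩ := y
  simp only at ht
  symm
  have hne : ∀ x, τ x + t + ε ≠ 0 := fun x => (hε.trans_le (hden x t ht)).ne'
  have hdτ : ∀ x ∈ interior (Function.support p), DifferentiableAt ℝ τ x :=
    fun x hx => hp.differentiableAt_steinKernel hx
  refine hp.integral_steinKernel_mul (D := (fun x => x + s) ⁻¹' D) (M := M / ε)
    (ψ := fun x => u (x + s) / (τ x + t + ε))
    (hD.preimage (add_left_injective s)) (fun x => b1 x s t ht) (by fun_prop) ?_ ?_ ?_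
  · intro x hx
    refine ContinuousAt.continuousWithinAt (ContinuousAt.div ?_ ?_ (hne x))
    · exact (hu.continuous.comp (continuous_id.add continuous_const)).continuousAt
    · exact ((hdτ x hx).continuousAt.add continuousAt_const).add continuousAt_const
  · intro x hx
    have h1 : HasDerivAt (fun x => u (x + s)) (u' (x + s)) x :=
      (hDd (x + s) hx.2).comp_add_const x s
    have h2 := h1.div (((hdτ x hx.1).hasDerivAt.add_const t).add_const ε) (hne x)
    refine h2.congr_deriv ?_
    have := hne x
    field_simp
  · refine (integrable_map_measure (f := X) (μ := P)
      (g := fun x => g₂ (x, (s, t))) ?_ hX.aemeasurable).2 ?_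
    · exact (hg₂.comp (measurable_id.prodMk measurable_const)).aestronglyMeasurable
    · refine ((hτ.const_mul (M / ε)).add (hττ.norm.const_mul (M / ε ^ 2))).mono'
        (hg₂.comp (hX.prodMk measurable_const)).aestronglyMeasurable (ae_of_all _ fun ω => ?_)
      exact b2 _ _ _ ht

end Independent

/-- Independent centered variables with interval densities whose Stein kernels `τ` are such that
`τ(X)` and `τ(X) τ'(X)` are integrable. -/
structure IsSteinSequence {Ω : Type*} [MeasurableSpace Ω] (P : Measure Ω) (X : ℕ → Ω → ℝ)
    (p : ℕ → ℝ → ℝ) : Prop where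
  measurable : ∀ k, Measurable (X k)
  indep : iIndepFun X P
  density : ∀ k, IsCenteredDensity (P.map (X k)) (p k)
  integrable_kernel : ∀ k, Integrable (fun ω => steinKernel (p k) (X k ω)) P
  integrable_kernel_mul_deriv : ∀ k, Integrable
    (fun ω => steinKernel (p k) (X k ω) * deriv (steinKernel (p k)) (X k ω)) P

/-- The sum `τ₁(X₁)τ₁'(X₁) + ⋯ + τₙ(Xₙ)τₙ'(Xₙ)`. -/
noncomputable def kernelDerivSum {Ω : Type*} (X : ℕ → Ω → ℝ) (p : ℕ → ℝ → ℝ) (n : ℕ) (ω : Ω) : ℝ :=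
  ∑ k ∈ Finset.range n, steinKernel (p k) (X k ω) * deriv (steinKernel (p k)) (X k ω)

/-- The sum `X₁ + ⋯ + Xₙ`. -/
noncomputable def partialSum {Ω : Type*} (X : ℕ → Ω → ℝ) (n : ℕ) (ω : Ω) : ℝ :=
  ∑ k ∈ Finset.range n, X k ω

namespace IsSteinSequence

variable {Ω : Type*} [MeasurableSpace Ω] {P : Measure Ω} {X : ℕ → Ω → ℝ}
  {p : ℕ → ℝ → ℝ}

lemma steinSum_nonneg (h : IsSteinSequence P X p) (n : ℕ) (ω : Ω) : 0 ≤ steinSum X p n ω :=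
  Finset.sum_nonneg fun k _ => (h.density k).steinKernel_nonneg _

lemma measurable_kernel (h : IsSteinSequence P X p) (k : ℕ) :
    Measurable fun ω => steinKernel (p k) (X k ω) :=
  (h.density k).measurable_steinKernel.comp (h.measurable k)

lemma measurable_kernel_deriv (h : IsSteinSequence P X p) (k : ℕ) :
    Measurable fun ω => deriv (steinKernel (p k)) (X k ω) :=
  (measurable_deriv _).comp (h.measurable k)

lemma measurable_steinSum (h : IsSteinSequence P X p) (n : ℕ) : Measurable (steinSum X p n) :=
  Finset.measurable_sum _ fun k _ => h.measurable_kernel k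

lemma measurable_partialSum (h : IsSteinSequence P X p) (n : ℕ) : Measurable (partialSum X n) :=
  Finset.measurable_sum _ fun k _ => h.measurable k

lemma measurable_kernelDerivSum (h : IsSteinSequence P X p) (n : ℕ) :
    Measurable (kernelDerivSum X p n) :=
  Finset.measurable_sum _ fun k _ => (h.measurable_kernel k).mul (h.measurable_kernel_deriv k)

/-- The two partial sums have to be independent of `X k` jointly, so they are treated as one sum of
independent vectors in ℝ × ℝ. -/
lemma indepFun_sum_erase (h : IsSteinSequence P X p) (n k : ℕ) :
    IndepFun (X k) (fun ω => (∑ j ∈ (Finset.range n).erase k, X j ω,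
      ∑ j ∈ (Finset.range n).erase k, steinKernel (p j) (X j ω))) P := by
  have hg : ∀ j, Measurable fun x : ℝ => (x, steinKernel (p j) x) := fun j =>
    measurable_id.prodMk (h.density j).measurable_steinKernel
  have hI : iIndepFun (fun j ω => (X j ω, steinKernel (p j) (X j ω))) P :=
    h.indep.comp _ hg
  have h1 := hI.indepFun_finsetSum_of_notMem (fun j => (hg j).comp (h.measurable j))
    (Finset.notMem_erase k (Finset.range n))
  have h2 := h1.symm.comp (measurable_fst) measurable_id
  have e : (fun ω => (∑ j ∈ (Finset.range n).erase k, X j ω,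
      ∑ j ∈ (Finset.range n).erase k, steinKernel (p j) (X j ω))) =
      id ∘ ∑ j ∈ (Finset.range n).erase k, fun ω => (X j ω, steinKernel (p j) (X j ω)) := by
    funext ω
    ext <;> simp [Finset.sum_apply, Prod.fst_sum, Prod.snd_sum]
  rw [e]
  exact h2

variable [IsProbabilityMeasure P]

/-- The one-variable identity for u(S)/(T + ε), added over the variables. The k-th derivative of T
is τ_k'(X_k), which multiplied by τ_k(X_k) sums to Q. -/
lemma integral_regularized (h : IsSteinSequence P X p) {u u' : ℝ → ℝ} {M ε : ℝ}
    (hu : IsTestFunction u u' M) (hε : 0 < ε) (n : ℕ) :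
    ∫ ω, partialSum X n ω * u (partialSum X n ω) / (steinSum X p n ω + ε) ∂P =
      ∫ ω, (steinSum X p n ω * u' (partialSum X n ω) / (steinSum X p n ω + ε) -
        kernelDerivSum X p n ω * u (partialSum X n ω) / (steinSum X p n ω + ε) ^ 2) ∂P := by
  have key := fun k (hk : k ∈ Finset.range n) => integral_mul_div_steinKernel (h.measurable k)
    ((Finset.measurable_sum _ fun j _ => h.measurable j).prodMk
      (Finset.measurable_sum _ fun j _ => h.measurable_kernel j))
    (h.indepFun_sum_erase n k) (h.density k)
    (fun ω => Finset.sum_nonneg (s := (Finset.range n).erase k)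
      (f := fun j => steinKernel (p j) (X j ω)) fun j _ => (h.density j).steinKernel_nonneg _)
    (h.integrable_kernel k) (h.integrable_kernel_mul_deriv k) hu hε
  have e1 : ∀ k ∈ Finset.range n, ∀ ω, X k ω + ∑ j ∈ (Finset.range n).erase k, X j ω
      = partialSum X n ω := fun k hk ω => Finset.add_sum_erase _ (fun j => X j ω) hk
  have e2 : ∀ k ∈ Finset.range n, ∀ ω, steinKernel (p k) (X k ω) +
      ∑ j ∈ (Finset.range n).erase k, steinKernel (p j) (X j ω) = steinSum X p n ω :=
    fun k hk ω => Finset.add_sum_erase _ (fun j => steinKernel (p j) (X j ω)) hk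
  have key' : ∀ k ∈ Finset.range n,
      Integrable (fun ω => X k ω * (u (partialSum X n ω) / (steinSum X p n ω + ε))) P ∧
      Integrable (fun ω => steinKernel (p k) (X k ω) *
        (u' (partialSum X n ω) / (steinSum X p n ω + ε) -
          deriv (steinKernel (p k)) (X k ω) * u (partialSum X n ω) /
            (steinSum X p n ω + ε) ^ 2)) P ∧
      ∫ ω, X k ω * (u (partialSum X n ω) / (steinSum X p n ω + ε)) ∂P =
        ∫ ω, steinKernel (p k) (X k ω) *
        (u' (partialSum X n ω) / (steinSum X p n ω + ε) -
          deriv (steinKernel (p k)) (X k ω) * u (partialSum X n ω) /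
            (steinSum X p n ω + ε) ^ 2) ∂P := by
    intro k hk
    simpa only [e1 k hk, e2 k hk] using key k hk
  calc _ = ∫ ω, ∑ k ∈ Finset.range n,
        X k ω * (u (partialSum X n ω) / (steinSum X p n ω + ε)) ∂P := by
        refine integral_congr_ae (ae_of_all _ fun ω => ?_)
        simp only [← Finset.sum_mul]
        rw [mul_div_assoc]; rfl
    _ = ∫ ω, ∑ k ∈ Finset.range n, steinKernel (p k) (X k ω) *
        (u' (partialSum X n ω) / (steinSum X p n ω + ε) -
          deriv (steinKernel (p k)) (X k ω) * u (partialSum X n ω) /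
            (steinSum X p n ω + ε) ^ 2) ∂P := by
        rw [integral_finsetSum _ fun k hk => (key' k hk).1,
          integral_finsetSum _ fun k hk => (key' k hk).2.1]
        exact Finset.sum_congr rfl fun k hk => (key' k hk).2.2
    _ = _ := by
        refine integral_congr_ae (ae_of_all _ fun ω => ?_)
        simp only [mul_sub, Finset.sum_sub_distrib, ← mul_div_assoc, ← Finset.sum_div,
          ← mul_assoc, ← Finset.sum_mul]
        rfl

/-- The score of a sum of independent variables through their Stein kernels:
`E[u'(S)] = E[u(S) (S / T + Q / T²)]`. -/
theorem integral_deriv_eq (h : IsSteinSequence P X p) {u u' : ℝ → ℝ} {M : ℝ}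
    (hu : IsTestFunction u u' M) (n : ℕ) (hT : ∀ᵐ ω ∂P, steinSum X p n ω ≠ 0)
    (h₁ : Integrable (fun ω => partialSum X n ω / steinSum X p n ω) P)
    (h₂ : Integrable (fun ω => kernelDerivSum X p n ω / steinSum X p n ω ^ 2) P) :
    ∫ ω, u' (partialSum X n ω) ∂P = ∫ ω, u (partialSum X n ω) *
      (partialSum X n ω / steinSum X p n ω + kernelDerivSum X p n ω / steinSum X p n ω ^ 2) ∂P := by
  have hM := hu.nonneg
  have mS := h.measurable_partialSum n
  have mT := h.measurable_steinSum n
  have mQ := h.measurable_kernelDerivSum n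
  have mu := hu.continuous.measurable
  have mu' := hu.measurable
  have hpos : ∀ᵐ ω ∂P, 0 < steinSum X p n ω := by
    filter_upwards [hT] with ω hω
    exact lt_of_le_of_ne (h.steinSum_nonneg n ω) hω.symm
  set S := partialSum X n
  set T := steinSum X p n
  set Q := kernelDerivSum X p n
  have hε : ∀ m : ℕ, (0 : ℝ) < 1 / ((m : ℝ) + 1) := fun m => by positivity
  have hlim : ∀ ω, Tendsto (fun m : ℕ => T ω + 1 / ((m : ℝ) + 1)) atTop (𝓝 (T ω)) := fun ω => by
    simpa using (tendsto_const_nhds (x := T ω)).add tendsto_one_div_add_atTop_nhds_zero_nat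
  -- Now ε = 1/(m+1) → 0. Since T > 0 almost surely, the regularized quotients are dominated by
  -- those with ε = 0, which are integrable by hypothesis.
  have L1 : Tendsto (fun m : ℕ => ∫ ω, S ω * u (S ω) / (T ω + 1 / ((m : ℝ) + 1)) ∂P) atTop
      (𝓝 (∫ ω, S ω * u (S ω) / T ω ∂P)) := by
    refine tendsto_integral_of_dominated_convergence (fun ω => M * ‖S ω / T ω‖)
      (fun m => (by fun_prop : Measurable _).aestronglyMeasurable) (h₁.norm.const_mul M)
      (fun m => ?_) ?_
    · filter_upwards [hpos] with ω hω
      rw [mul_comm (S ω), mul_div_assoc, norm_mul]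
      refine mul_le_mul (hu.bound _) ?_ (norm_nonneg _) hM
      rw [norm_div, norm_div, Real.norm_of_nonneg hω.le,
        Real.norm_of_nonneg (r := T ω + _)]
      · exact div_le_div_of_nonneg_left (norm_nonneg _) hω (by linarith [hε m])
      · linarith [hε m]
    · filter_upwards [hpos] with ω hω
      exact tendsto_const_nhds.div (hlim ω) hω.ne'
  have L2 : Tendsto (fun m : ℕ => ∫ ω, (T ω * u' (S ω) / (T ω + 1 / ((m : ℝ) + 1)) -
      Q ω * u (S ω) / (T ω + 1 / ((m : ℝ) + 1)) ^ 2) ∂P) atTop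
      (𝓝 (∫ ω, (T ω * u' (S ω) / T ω - Q ω * u (S ω) / T ω ^ 2) ∂P)) := by
    refine tendsto_integral_of_dominated_convergence (fun ω => M + M * ‖Q ω / T ω ^ 2‖)
      (fun m => (by fun_prop : Measurable _).aestronglyMeasurable)
      ((integrable_const M).add (h₂.norm.const_mul M)) (fun m => ?_) ?_
    · filter_upwards [hpos] with ω hω
      refine (norm_sub_le _ _).trans (add_le_add ?_ ?_)
      · have h3 : 0 < T ω + 1 / ((m : ℝ) + 1) := by linarith [hε m]
        rw [norm_div, norm_mul, Real.norm_of_nonneg hω.le, Real.norm_of_nonneg h3.le,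
          div_le_iff₀ h3, mul_comm]
        exact mul_le_mul (hu.bound' _) (by linarith [hε m]) hω.le hM
      · rw [mul_comm (Q ω), mul_div_assoc, norm_mul]
        refine mul_le_mul (hu.bound _) ?_ (norm_nonneg _) hM
        rw [norm_div, norm_div, norm_pow, norm_pow, Real.norm_of_nonneg hω.le,
          Real.norm_of_nonneg (r := T ω + _)]
        · refine div_le_div_of_nonneg_left (norm_nonneg _) (by positivity) ?_
          exact pow_le_pow_left₀ hω.le (by linarith [hε m]) 2
        · linarith [hε m]
    · filter_upwards [hpos] with ω hω
      exact (tendsto_const_nhds.div (hlim ω) hω.ne').sub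
        (tendsto_const_nhds.div ((hlim ω).pow 2) (by positivity))
  have e := tendsto_nhds_unique (L1.congr fun m => h.integral_regularized hu (hε m) n) L2
  have i1 : Integrable (fun ω => u' (S ω)) P :=
    (integrable_const M).mono' (mu'.comp mS).aestronglyMeasurable (ae_of_all _ fun ω => hu.bound' _)
  have i2 : Integrable (fun ω => u (S ω) * (S ω / T ω)) P :=
    (h₁.norm.const_mul M).mono' (by fun_prop) (ae_of_all _ fun ω => by
      rw [norm_mul]; exact mul_le_mul_of_nonneg_right (hu.bound _) (norm_nonneg _))
  have i3 : Integrable (fun ω => u (S ω) * (Q ω / T ω ^ 2)) P :=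
    (h₂.norm.const_mul M).mono' (by fun_prop) (ae_of_all _ fun ω => by
      rw [norm_mul]; exact mul_le_mul_of_nonneg_right (hu.bound _) (norm_nonneg _))
  have e3 : ∫ ω, (T ω * u' (S ω) / T ω - Q ω * u (S ω) / T ω ^ 2) ∂P =
      ∫ ω, u' (S ω) ∂P - ∫ ω, u (S ω) * (Q ω / T ω ^ 2) ∂P := by
    rw [← integral_sub i1 i3]
    refine integral_congr_ae ?_
    filter_upwards [hpos] with ω hω
    have := hω.ne'
    field_simp
  have e4 : ∫ ω, S ω * u (S ω) / T ω ∂P = ∫ ω, u (S ω) * (S ω / T ω) ∂P :=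
    integral_congr_ae (ae_of_all _ fun ω => by simp only; ring)
  simp_rw [mul_add]
  rw [integral_add i2 i3]
  rw [e3, e4] at e
  linarith

end IsSteinSequence

/-! ### Fisher information distance through an integration by parts identity -/

/-- The ramp max a (min b y) - a, which serves as test function φ with φ' the indicator of (a, b],
is a superposition of the steps 1_{x < y}. -/
lemma setIntegral_indicator_Iio {a b : ℝ} (hab : a ≤ b) (y : ℝ) :
    ∫ x in Set.Ioc a b, (Set.Iio y).indicator (fun _ => (1 : ℝ)) x = max a (min b y) - a := by
  rw [setIntegral_indicator measurableSet_Iio, setIntegral_const, smul_eq_mul, mul_one]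
  rcases le_or_gt y a with h | h
  · have : Set.Ioc a b ∩ Set.Iio y = ∅ := by
      ext x; simp only [mem_inter_iff, mem_Ioc, mem_Iio, mem_empty_iff_false, iff_false]
      rintro ⟨⟨h1, _⟩, h2⟩; linarith
    rw [this, max_eq_left ((min_le_right _ _).trans h)]
    simp
  rcases le_or_gt y b with hb | hb
  · have : Set.Ioc a b ∩ Set.Iio y = Set.Ioo a y := by
      ext x; simp only [mem_inter_iff, mem_Ioc, mem_Iio, mem_Ioo]
      exact ⟨fun h => ⟨h.1.1, h.2⟩, fun h => ⟨⟨h.1, h.2.le.trans hb⟩, h.2⟩⟩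
    rw [this, min_eq_right hb, max_eq_right h.le, Real.volume_real_Ioo_of_le h.le]
  · have : Set.Ioc a b ∩ Set.Iio y = Set.Ioc a b := by
      refine inter_eq_left.2 fun x hx => lt_of_le_of_lt hx.2 hb
    rw [this, min_eq_left hb.le, max_eq_right hab, Real.volume_real_Ioc_of_le hab]

section

variable {Ω : Type*} [mΩ : MeasurableSpace Ω] {P : Measure Ω}

/-- The function `x ↦ E[G 1_{x < F}]`. -/
noncomputable def tailExpectation (P : Measure Ω) (F G : Ω → ℝ) (x : ℝ) : ℝ :=
  ∫ ω, (Set.Iio (F ω)).indicator (fun _ => (1 : ℝ)) x * G ω ∂P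

variable {F G : Ω → ℝ}

lemma tailExpectation_eq_setIntegral (hF : Measurable F) (x : ℝ) :
    tailExpectation P F G x = ∫ ω in F ⁻¹' Set.Ioi x, G ω ∂P := by
  rw [← integral_indicator (hF measurableSet_Ioi)]
  refine integral_congr_ae (ae_of_all _ fun ω => ?_)
  by_cases h : x < F ω <;> simp [h]

lemma integrable_prod_indicator_mul [IsProbabilityMeasure P] (hF : Measurable F)
    (hG : Integrable G P) (a b : ℝ) :
    Integrable (fun z : ℝ × Ω => (Set.Iio (F z.2)).indicator (fun _ => (1 : ℝ)) z.1 * G z.2)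
      ((volume.restrict (Set.Ioc a b)).prod P) := by
  have h1 : Integrable (fun z : ℝ × Ω => G z.2) ((volume.restrict (Set.Ioc a b)).prod P) :=
    hG.comp_snd _
  have e : (fun z : ℝ × Ω => (Set.Iio (F z.2)).indicator (fun _ => (1 : ℝ)) z.1 * G z.2) =
      {z : ℝ × Ω | z.1 < F z.2}.indicator fun z => G z.2 := by
    ext z
    by_cases h : z.1 < F z.2 <;> simp [h]
  rw [e]
  exact h1.indicator (measurableSet_lt measurable_fst (hF.comp measurable_snd))

/-- Fubini. When E[G φ(F)] = P(a < F ≤ b) for every ramp φ, this says that x ↦ E[G 1_{x < F}] is a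
density of F. -/
lemma setIntegral_tailExpectation [IsProbabilityMeasure P] (hF : Measurable F)
    (hG : Integrable G P) {a b : ℝ}
    (hab : a ≤ b) : IntegrableOn (tailExpectation P F G) (Set.Ioc a b) ∧
      ∫ x in Set.Ioc a b, tailExpectation P F G x =
        ∫ ω, (max a (min b (F ω)) - a) * G ω ∂P := by
  have hi := integrable_prod_indicator_mul (P := P) hF hG a b
  refine ⟨hi.integral_prod_left, ?_⟩
  unfold tailExpectation
  rw [integral_integral_swap hi]
  refine integral_congr_ae (ae_of_all _ fun ω => ?_)
  simp only
  rw [integral_mul_const, setIntegral_indicator_Iio hab]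

/-- Each step x ↦ 1_{x < F} is right-continuous. This is needed to pass from signs of averages to
signs at every point. -/
lemma continuousWithinAt_tailExpectation (hF : Measurable F) (hG : Integrable G P) (x : ℝ) :
    ContinuousWithinAt (tailExpectation P F G) (Set.Ici x) x := by
  refine continuousWithinAt_of_dominated (bound := fun ω => ‖G ω‖) (Eventually.of_forall
    fun y => ?_) (Eventually.of_forall fun y => ae_of_all _ fun ω => ?_) hG.norm
    (ae_of_all _ fun ω => ?_)
  · have : (fun ω => (Set.Iio (F ω)).indicator (fun _ => (1 : ℝ)) y) =
        (F ⁻¹' Set.Ioi y).indicator fun _ => 1 := by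
      ext ω; by_cases h : y < F ω <;> simp [h]
    refine AEStronglyMeasurable.mul ?_ hG.aestronglyMeasurable
    rw [this]
    exact (measurable_const.indicator (hF measurableSet_Ioi)).aestronglyMeasurable
  · by_cases h : y < F ω <;> simp [h]
  · refine ContinuousWithinAt.mul ?_ continuousWithinAt_const
    by_cases h : x < F ω
    · refine (ContinuousAt.congr (f := fun _ => (1 : ℝ)) continuousAt_const ?_).continuousWithinAt
      filter_upwards [Iio_mem_nhds h] with y hy
      simp [show y < F ω from hy]
    · refine ContinuousWithinAt.congr (f := fun _ => (0 : ℝ)) continuousWithinAt_const ?_ ?_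
      · intro y hy
        simp only [not_lt] at h
        simp [h.trans hy]
      · simp [h]

/-- A negative value would persist on some [x, b) by right-continuity and make the integral over a
subinterval negative. -/
lemma tailExpectation_nonneg [IsProbabilityMeasure P] (hF : Measurable F) (hG : Integrable G P)
    (h : ∀ a b, a < b → 0 ≤ ∫ ω, (max a (min b (F ω)) - a) * G ω ∂P) (x : ℝ) :
    0 ≤ tailExpectation P F G x := by
  by_contra! hx
  have hc := (continuousWithinAt_tailExpectation hF hG x).eventually
    (Iio_mem_nhds (show tailExpectation P F G x < tailExpectation P F G x / 2 by linarith))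
  obtain ⟨b, hb, hxb⟩ := mem_nhdsGE_iff_exists_Ico_subset.1 hc
  simp only [mem_Ioi] at hb
  set c := (x + b) / 2 with hcdef
  have hxc : x < c := by simp only [hcdef]; linarith
  have hcb : c < b := by simp only [hcdef]; linarith
  obtain ⟨hi, e⟩ := setIntegral_tailExpectation (P := P) hF hG hxc.le
  have h1 := h x c hxc
  rw [← e] at h1
  have h2 : ∫ y in Set.Ioc x c, tailExpectation P F G y ≤
      ∫ y in Set.Ioc x c, tailExpectation P F G x / 2 :=
    setIntegral_mono_on hi (integrableOn_const (by simp)) measurableSet_Ioc fun y hy =>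
      le_of_lt (hxb ⟨hy.1.le, hy.2.trans_lt hcb⟩)
  rw [setIntegral_const, Real.volume_real_Ioc_of_le hxc.le, smul_eq_mul] at h2
  nlinarith

/-- If `P(a < F ≤ b) = E[G (a ∨ (b ∧ F) - a)]` for all `a < b`, then `F` has an absolutely continuous
density whose logarithmic derivative at `F` is `-E[G | F]`. -/
theorem fisherDist_le_of_integral_eq [IsProbabilityMeasure P]
    (hF : Measurable F) (hFi : Integrable F P)
    (hG : Integrable G P)
    (h : ∀ a b, a < b → P.real (F ⁻¹' Set.Ioc a b) = ∫ ω, (max a (min b (F ω)) - a) * G ω ∂P) :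
    fisherDist P F 0 1 ≤ ∫⁻ ω, ENNReal.ofReal ((F ω - G ω) ^ 2) ∂P := by
  have hm : MeasurableSpace.comap F inferInstance ≤ mΩ := hF.comap_le
  -- E[G | F] = r(F) with r measurable, so the candidate density is p(x) = ∫_(x, ∞) r dP_F.
  obtain ⟨r, hr, hrF⟩ := (stronglyMeasurable_condExp
    (m := MeasurableSpace.comap F inferInstance) (μ := P)
    (f := G)).measurable.exists_eq_measurable_comp
  set p := tailExpectation P F G with hp
  have hp0 : ∀ x, 0 ≤ p x := tailExpectation_nonneg hF hG fun a b hab => by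
    rw [← h a b hab]; exact measureReal_nonneg
  have hrF' : Integrable (r ∘ F) P := hrF ▸ integrable_condExp
  have hset : ∀ s, MeasurableSet s → ∫ ω in F ⁻¹' s, G ω ∂P = ∫ x in s, r x ∂(P.map F) := by
    intro s hs
    rw [← setIntegral_condExp hm hG ⟨s, hs, rfl⟩, hrF,
      setIntegral_map hs hr.aestronglyMeasurable hF.aemeasurable]
    rfl
  have hpm : Measurable p := by
    have e : p = fun x => ∫ y, (Set.Ioi x).indicator r y ∂(P.map F) := by
      ext x
      rw [hp, tailExpectation_eq_setIntegral hF, hset _ measurableSet_Ioi,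
        integral_indicator measurableSet_Ioi]
    have := Measure.isProbabilityMeasure_map (μ := P) hF.aemeasurable
    rw [e]
    refine (StronglyMeasurable.integral_prod_right
      (f := fun x y => (Set.Ioi x).indicator r y) ?_).measurable
    have e2 : (Function.uncurry fun x y => (Set.Ioi x).indicator r y) =
        {z : ℝ × ℝ | z.1 < z.2}.indicator fun z => r z.2 := by
      ext z
      by_cases h : z.1 < z.2 <;> simp [Function.uncurry, h]
    rw [e2]
    exact ((hr.comp measurable_snd).indicator
      (measurableSet_lt measurable_fst measurable_snd)).stronglyMeasurable
  have hdens : P.map F = volume.withDensity fun x => ENNReal.ofReal (p x) := by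
    have := Measure.isProbabilityMeasure_map (μ := P) hF.aemeasurable
    refine Measure.ext_of_Ioc _ _ fun a b hab => ?_
    obtain ⟨hi, e⟩ := setIntegral_tailExpectation (P := P) hF hG hab.le
    rw [withDensity_apply _ measurableSet_Ioc, ← ofReal_integral_eq_lintegral_ofReal hi
      (ae_of_all _ hp0), e, ← h a b hab, Measure.map_apply hF measurableSet_Ioc, ofReal_measureReal]
  have hq : ∀ g : ℝ → ℝ, ∀ s, MeasurableSet s →
      ∫ x in s, g x ∂(P.map F) = ∫ x in s, p x * g x := by
    intro g s hs
    rw [hdens, setIntegral_withDensity_eq_setIntegral_toReal_smul hpm.ennreal_ofReal (by simp) _ hs]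
    simp [ENNReal.toReal_ofReal (hp0 _)]
  have hqi : Integrable fun x => p x * r x := by
    have h1 : Integrable r (P.map F) :=
      (integrable_map_measure hr.aestronglyMeasurable hF.aemeasurable).2 hrF'
    rw [hdens, integrable_withDensity_iff_integrable_smul' hpm.ennreal_ofReal (by simp)] at h1
    simpa [ENNReal.toReal_ofReal (hp0 _)] using h1
  -- As P_F itself has density p, the formula for p becomes p(x) = ∫_x^∞ r p, so p is absolutely
  -- continuous with p' = -r p and score -r.
  have hAC : IsACDensity (P.map F) p (fun x => -(p x * r x)) := by
    refine ⟨hp0, hdens, fun a b => hqi.neg.intervalIntegrable, ?_⟩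
    have key : ∀ a b : ℝ, a ≤ b → ∫ x in a..b, -(p x * r x) = p b - p a := by
      intro a b hab
      rw [intervalIntegral.integral_of_le hab, integral_neg, ← hq r _ measurableSet_Ioc,
        ← hset _ measurableSet_Ioc, hp, tailExpectation_eq_setIntegral hF,
        tailExpectation_eq_setIntegral hF]
      have : F ⁻¹' Set.Ioi a = F ⁻¹' Set.Ioc a b ∪ F ⁻¹' Set.Ioi b := by
        rw [← preimage_union, Ioc_union_Ioi_eq_Ioi hab]
      rw [this, setIntegral_union _ (hF measurableSet_Ioi) hG.integrableOn hG.integrableOn]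
      · ring
      · exact (Set.Ioc_disjoint_Ioi le_rfl).preimage F
    intro a b
    rcases le_total a b with hab | hab
    · exact key a b hab
    · rw [intervalIntegral.integral_symm, key b a hab]; ring
  have hpos : ∀ᵐ ω ∂P, p (F ω) ≠ 0 := by
    have : ∀ᵐ x ∂(P.map F), p x ≠ 0 := by
      rw [hdens, ae_withDensity_iff hpm.ennreal_ofReal]
      exact ae_of_all _ fun x hx h0 => by simp [h0] at hx
    exact ae_of_ae_map hF.aemeasurable this
  -- Score plus identity at F is the conditional expectation of F - G given F; its L² norm is at
  -- most that of F - G.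
  have hce : P[F - G | MeasurableSpace.comap F inferInstance] =ᵐ[P] fun ω => F ω - r (F ω) := by
    refine (condExp_sub hFi hG _).trans ?_
    rw [hrF, condExp_of_stronglyMeasurable hm
      (comap_measurable F).stronglyMeasurable hFi]
    rfl
  have hsq : ∀ f : Ω → ℝ, ∫⁻ ω, ENNReal.ofReal (f ω ^ 2) ∂P = eLpNorm f 2 P ^ 2 := by
    intro f
    have := eLpNorm_nnreal_pow_eq_lintegral (μ := P) (f := f) (p := 2) two_ne_zero
    simp only [NNReal.coe_ofNat, ENNReal.rpow_ofNat, ENNReal.coe_ofNat] at this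
    rw [this]
    refine lintegral_congr fun ω => ?_
    rw [← Real.enorm_of_nonneg (sq_nonneg _), enorm_pow]
  calc fisherDist P F 0 1
      ≤ ∫⁻ ω, ENNReal.ofReal ((-(p (F ω) * r (F ω)) / p (F ω) + (F ω - 0) / 1) ^ 2) ∂P :=
        iInf_le_of_le p (iInf_le_of_le _ (iInf_le_of_le hAC le_rfl))
    _ = ∫⁻ ω, ENNReal.ofReal
          ((P[F - G | MeasurableSpace.comap F inferInstance]) ω ^ 2) ∂P := by
        refine lintegral_congr_ae ?_
        filter_upwards [hpos, hce] with ω h1 h2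
        rw [h2]
        congr 2
        field_simp
        ring
    _ ≤ ∫⁻ ω, ENNReal.ofReal ((F ω - G ω) ^ 2) ∂P := by
        rw [hsq, hsq fun ω => F ω - G ω]
        exact pow_le_pow_left₀ (by simp) (eLpNorm_condExp_le_eLpNorm _ one_le_two) 2

end

/-! ### Ramps composed with a smooth monotone function. -/

lemma injective_of_hasDerivAt_ne_zero {f f' : ℝ → ℝ} (hf : ∀ x, HasDerivAt f (f' x) x)
    (h0 : ∀ x, f' x ≠ 0) : Function.Injective f := by
  have key : ∀ a b, a < b → f a ≠ f b := by
    intro a b hab he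
    obtain ⟨c, -, hc⟩ := exists_hasDerivAt_eq_zero hab
      (fun x _ => (hf x).continuousAt.continuousWithinAt) he (fun x _ => hf x)
    exact h0 c hc
  intro a b he
  by_contra hne
  rcases lt_or_gt_of_ne hne with h | h
  · exact key a b h he
  · exact key b a h he.symm

lemma hasDerivAt_ramp {a b y : ℝ} (hab : a < b) (ha : y ≠ a) (hb : y ≠ b) :
    HasDerivAt (fun y => max a (min b y) - a) ((Set.Ioc a b).indicator (fun _ => (1 : ℝ)) y) y := by
  rcases lt_or_gt_of_ne ha with h | h
  · have e : (fun y => max a (min b y) - a) =ᶠ[𝓝 y] fun _ => 0 := by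
      filter_upwards [Iio_mem_nhds h] with z hz
      rw [max_eq_left ((min_le_right _ _).trans (le_of_lt hz)), sub_self]
    rw [Set.indicator_of_notMem fun h' => absurd h'.1 (not_lt.2 h.le)]
    exact (hasDerivAt_const y (0 : ℝ)).congr_of_eventuallyEq e
  rcases lt_or_gt_of_ne hb with h' | h'
  · have e : (fun y => max a (min b y) - a) =ᶠ[𝓝 y] fun y => y - a := by
      filter_upwards [Ioo_mem_nhds h h'] with z hz
      rw [min_eq_right hz.2.le, max_eq_right hz.1.le]
    rw [Set.indicator_of_mem (show y ∈ Set.Ioc a b from ⟨h, h'.le⟩)]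
    exact ((hasDerivAt_id y).sub_const a).congr_of_eventuallyEq e
  · have e : (fun y => max a (min b y) - a) =ᶠ[𝓝 y] fun _ => b - a := by
      filter_upwards [Ioi_mem_nhds h'] with z hz
      rw [min_eq_left (le_of_lt hz), max_eq_right hab.le]
    rw [Set.indicator_of_notMem fun h2 => absurd h2.2 (not_le.2 h')]
    exact (hasDerivAt_const y (b - a)).congr_of_eventuallyEq e

lemma abs_ramp_le {a b : ℝ} (hab : a < b) (y : ℝ) : |max a (min b y) - a| ≤ b - a := by
  rw [abs_of_nonneg (by linarith [le_max_left a (min b y)])]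
  have : max a (min b y) ≤ b := max_le hab.le (min_le_left _ _)
  linarith

/-- For a ramp φ, the quotient u = φ(f)/f' has u' = φ'(f) - φ(f) f''/f'², which turns the identity
for S into one for f(S). The kinks of φ pull back to at most two points because f is injective. The
constant is the sum of a bound for u and a bound for u', as one number must serve both. -/
lemma isTestFunction_ramp_comp_div {f f' f'' : ℝ → ℝ} {c K a b : ℝ}
    (hf : ∀ x, HasDerivAt f (f' x) x) (hf' : ∀ x, HasDerivAt f' (f'' x) x) (hc : 0 < c)
    (hcf : ∀ x, c ≤ |f' x|) (hK : ∀ x, |f'' x| ≤ K) (hm : Measurable f'') (hab : a < b) :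
    IsTestFunction (fun x => (max a (min b (f x)) - a) / f' x)
      (fun x => (Set.Ioc a b).indicator (fun _ => (1 : ℝ)) (f x) -
        (max a (min b (f x)) - a) * f'' x / f' x ^ 2)
      ((b - a) / c + (1 + (b - a) * K / c ^ 2)) := by
  have hfc : Continuous f := continuous_iff_continuousAt.2 fun x => (hf x).continuousAt
  have hfc' : Continuous f' := continuous_iff_continuousAt.2 fun x => (hf' x).continuousAt
  have h0 : ∀ x, f' x ≠ 0 := fun x h => by have := hcf x; rw [h, abs_zero] at this; linarith
  have hK0 : 0 ≤ K := (abs_nonneg _).trans (hK 0)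
  have hba : 0 < b - a := sub_pos.2 hab
  refine ⟨?_, ?_, fun x => ?_, fun x => ?_, f ⁻¹' {a, b}, ?_, fun x hx => ?_⟩
  · exact ((continuous_const.max (continuous_const.min hfc)).sub continuous_const).div hfc' h0
  · refine ((measurable_const.indicator measurableSet_Ioc).comp hfc.measurable).sub ?_
    exact (((measurable_const.max (measurable_const.min hfc.measurable)).sub_const a).mul hm).div
      (hfc'.measurable.pow_const 2)
  · rw [abs_div]
    have h1 := div_le_div₀ hba.le (abs_ramp_le hab (f x)) hc (hcf x)
    have : 0 ≤ 1 + (b - a) * K / c ^ 2 := by positivity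
    linarith
  · refine (abs_sub _ _).trans ?_
    have h1 : |(Set.Ioc a b).indicator (fun _ => (1 : ℝ)) (f x)| ≤ 1 := by
      by_cases h : f x ∈ Set.Ioc a b <;> simp [h]
    have h2 : |(max a (min b (f x)) - a) * f'' x / f' x ^ 2| ≤ (b - a) * K / c ^ 2 := by
      rw [abs_div, abs_mul, abs_pow]
      exact div_le_div₀ (by positivity)
        (mul_le_mul (abs_ramp_le hab _) (hK x) (abs_nonneg _) hba.le) (by positivity)
        (pow_le_pow_left₀ hc.le (hcf x) 2)
    have : 0 ≤ (b - a) / c := by positivity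
    linarith
  · exact (Set.toFinite {a, b}).countable.preimage (injective_of_hasDerivAt_ne_zero hf h0)
  · simp only [mem_preimage, mem_insert_iff, mem_singleton_iff, not_or] at hx
    have h1 := ((hasDerivAt_ramp hab hx.1 hx.2).comp x (hf x)).div (hf' x) (h0 x)
    refine h1.congr_deriv ?_
    have := h0 x
    simp only [Function.comp]
    field_simp

/-- The function `G` with `E[φ'(F)] = E[φ(F) G]` for `F = f(X₁ + ⋯ + Xₙ)`. -/
noncomputable def steinWeight {Ω : Type*} (X : ℕ → Ω → ℝ) (p : ℕ → ℝ → ℝ) (f' f'' : ℝ → ℝ) (n : ℕ)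
    (ω : Ω) : ℝ :=
  (partialSum X n ω / steinSum X p n ω + kernelDerivSum X p n ω / steinSum X p n ω ^ 2) /
    f' (partialSum X n ω) + f'' (partialSum X n ω) / f' (partialSum X n ω) ^ 2

/-- The Fisher information distance of a smooth monotone function of a sum of independent
variables. -/
theorem IsSteinSequence.fisherDist_le {Ω : Type*} [MeasurableSpace Ω] {P : Measure Ω}
    [IsProbabilityMeasure P] {X : ℕ → Ω → ℝ} {p : ℕ → ℝ → ℝ} (h : IsSteinSequence P X p)
    {f f' f'' : ℝ → ℝ} {c K : ℝ} {n : ℕ}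
    (hf : ∀ x, HasDerivAt f (f' x) x) (hf' : ∀ x, HasDerivAt f' (f'' x) x) (hc : 0 < c)
    (hcf : ∀ x, c ≤ |f' x|) (hK : ∀ x, |f'' x| ≤ K) (hm : Measurable f'')
    (hFi : Integrable (fun ω => f (partialSum X n ω)) P)
    (hT : ∀ᵐ ω ∂P, steinSum X p n ω ≠ 0)
    (h₁ : Integrable (fun ω => partialSum X n ω / steinSum X p n ω) P)
    (h₂ : Integrable (fun ω => kernelDerivSum X p n ω / steinSum X p n ω ^ 2) P) :
    fisherDist P (fun ω => f (partialSum X n ω)) 0 1 ≤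
      ∫⁻ ω, ENNReal.ofReal ((f (partialSum X n ω) - steinWeight X p f' f'' n ω) ^ 2) ∂P := by
  have hfc : Continuous f := continuous_iff_continuousAt.2 fun x => (hf x).continuousAt
  have hfc' : Continuous f' := continuous_iff_continuousAt.2 fun x => (hf' x).continuousAt
  have h0 : ∀ x, f' x ≠ 0 := fun x h => by have := hcf x; rw [h, abs_zero] at this; linarith
  have mS := h.measurable_partialSum n
  have mT := h.measurable_steinSum n
  have mQ := h.measurable_kernelDerivSum n
  have mf := hfc.measurable
  have mf' := hfc'.measurable
  have hw : Integrable (fun ω => (partialSum X n ω / steinSum X p n ω +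
      kernelDerivSum X p n ω / steinSum X p n ω ^ 2) / f' (partialSum X n ω)) P := by
    refine ((h₁.add h₂).norm.div_const c).mono'
      (by fun_prop : Measurable _).aestronglyMeasurable (ae_of_all _ fun ω => ?_)
    rw [norm_div]
    exact div_le_div_of_nonneg_left (norm_nonneg _) hc (hcf _)
  have hw2 : Integrable (fun ω => f'' (partialSum X n ω) / f' (partialSum X n ω) ^ 2) P := by
    refine (integrable_const (K / c ^ 2)).mono'
      (by fun_prop : Measurable _).aestronglyMeasurable (ae_of_all _ fun ω => ?_)
    rw [norm_div, norm_pow]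
    exact div_le_div₀ ((abs_nonneg _).trans (hK 0)) (hK _) (by positivity)
      (pow_le_pow_left₀ hc.le (hcf _) 2)
  have hbdd : ∀ a b : ℝ, a < b → ∀ g : Ω → ℝ, Integrable g P →
      Integrable (fun ω => (max a (min b (f (partialSum X n ω))) - a) * g ω) P := by
    intro a b hab g hg
    refine hg.bdd_mul (c := b - a) (by fun_prop : Measurable _).aestronglyMeasurable
      (ae_of_all _ fun ω => abs_ramp_le hab _)
  refine fisherDist_le_of_integral_eq (mf.comp mS) hFi (hw.add hw2) fun a b hab => ?_
  have key := h.integral_deriv_eq (isTestFunction_ramp_comp_div hf hf' hc hcf hK hm hab) n hT h₁ h₂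
  have i1 : Integrable (fun ω => (Set.Ioc a b).indicator (fun _ => (1 : ℝ))
      (f (partialSum X n ω))) P := by
    refine (integrable_const (1 : ℝ)).mono' (((measurable_const.indicator measurableSet_Ioc).comp
      (mf.comp mS))).aestronglyMeasurable (ae_of_all _ fun ω => ?_)
    by_cases h : f (partialSum X n ω) ∈ Set.Ioc a b <;> simp [h]
  have i2 := hbdd a b hab _ hw2
  have i3 := hbdd a b hab _ hw
  simp only [mul_div_assoc] at key
  rw [integral_sub i1 i2] at key
  have e1 : ∫ ω, (Set.Ioc a b).indicator (fun _ => (1 : ℝ)) (f (partialSum X n ω)) ∂P =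
      P.real ((fun ω => f (partialSum X n ω)) ⁻¹' Set.Ioc a b) := by
    exact (integral_indicator_one ((mf.comp mS) measurableSet_Ioc :
      MeasurableSet ((fun ω => f (partialSum X n ω)) ⁻¹' Set.Ioc a b)))
  rw [e1] at key
  have e2 := sub_eq_iff_eq_add.1 (key.trans (integral_congr_ae (ae_of_all _ fun ω =>
    (by ring : _ = (max a (min b (f (partialSum X n ω))) - a) * ((partialSum X n ω /
      steinSum X p n ω + kernelDerivSum X p n ω / steinSum X p n ω ^ 2) /
        f' (partialSum X n ω))))))
  rw [e2, ← integral_add i3 i2]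
  exact integral_congr_ae (ae_of_all _ fun ω => (mul_add _ _ _).symm)

/-! ### Eighth moments -/

/-- The linear term is kept exact because it will have mean zero. All later monomials are dominated
by a⁶b² + b⁸, and 247 = 2⁸ - 1 - 8 is the sum of their binomial coefficients. -/
lemma add_pow_eight_le (a b : ℝ) :
    (a + b) ^ 8 ≤ a ^ 8 + 8 * (a ^ 7 * b) + 247 * (a ^ 6 * b ^ 2 + b ^ 8) := by
  have hX : 0 ≤ a ^ 2 := sq_nonneg a
  have hY : 0 ≤ b ^ 2 := sq_nonneg b
  set X := a ^ 2 with hXd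
  set Y := b ^ 2 with hYd
  have h1 : 2 * (a * b) ≤ X + Y := by nlinarith [sq_nonneg (a - b)]
  have c1 : X ^ 2 * Y ≤ X ^ 3 + Y ^ 3 := by
    rcases le_total X Y with h | h
    · nlinarith [mul_le_mul (mul_le_mul h h hX hY) (le_refl Y) hY (mul_nonneg hY hY),
        pow_nonneg hX 3]
    · nlinarith [mul_le_mul_of_nonneg_left h (sq_nonneg X), pow_nonneg hY 3]
  have c2 : X * Y ^ 2 ≤ X ^ 3 + Y ^ 3 := by
    rcases le_total X Y with h | h
    · nlinarith [mul_le_mul_of_nonneg_right h (sq_nonneg Y), pow_nonneg hX 3]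
    · nlinarith [mul_le_mul (mul_le_mul h h hY hX) (le_refl X) hX (mul_nonneg hX hX),
        pow_nonneg hY 3]
  have d1 : 56 * (X ^ 2 * Y * (a * b)) ≤ 28 * (X ^ 2 * Y * (X + Y)) := by
    nlinarith [mul_le_mul_of_nonneg_left h1 (by positivity : 0 ≤ X ^ 2 * Y)]
  have d2 : 56 * (X * Y ^ 2 * (a * b)) ≤ 28 * (X * Y ^ 2 * (X + Y)) := by
    nlinarith [mul_le_mul_of_nonneg_left h1 (by positivity : 0 ≤ X * Y ^ 2)]
  have d3 : 8 * (Y ^ 3 * (a * b)) ≤ 4 * (Y ^ 3 * (X + Y)) := by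
    nlinarith [mul_le_mul_of_nonneg_left h1 (by positivity : 0 ≤ Y ^ 3)]
  have e1 := mul_le_mul_of_nonneg_left c1 hY
  have e2 := mul_le_mul_of_nonneg_left c2 hY
  have f1 : 0 ≤ Y * X ^ 3 := by positivity
  have f2 : 0 ≤ Y * Y ^ 3 := by positivity
  have id1 : (a + b) ^ 8 = a ^ 8 + 8 * (a ^ 7 * b) + 28 * (X ^ 3 * Y) +
      56 * (X ^ 2 * Y * (a * b)) + 70 * (X ^ 2 * Y ^ 2) + 56 * (X * Y ^ 2 * (a * b)) +
      28 * (X * Y ^ 3) + 8 * (Y ^ 3 * (a * b)) + Y ^ 4 := by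
    rw [hXd, hYd]; ring
  have id2 : a ^ 6 * b ^ 2 + b ^ 8 = Y * X ^ 3 + Y * Y ^ 3 := by rw [hXd, hYd]; ring
  rw [id1, id2]
  nlinarith

/-- The constant in the bound of the eighth moment of a sum of independent variables. -/
def momentConst : ℝ := 247 ^ 4 + 247

/-- Young's inequality trades a⁶b² for a⁸/m at the price of m³b⁸. With m = n the moments M_n of a
sum satisfy M_{n+1} ≤ (1 + 1/n) M_n + C n³, a recursion compatible with growth n⁴ since n³(n + 2) ≤
(n + 1)⁴. -/
lemma add_pow_eight_le_of_one_le (a b : ℝ) {m : ℝ} (hm : 1 ≤ m) :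
    (a + b) ^ 8 ≤ (1 + 1 / m) * a ^ 8 + 8 * (a ^ 7 * b) + momentConst * m ^ 3 * b ^ 8 := by
  have hm0 : 0 < m := by linarith
  refine (add_pow_eight_le a b).trans ?_
  have key : 247 * (a ^ 6 * b ^ 2) ≤ 1 / m * a ^ 8 + 247 ^ 4 * m ^ 3 * b ^ 8 := by
    have hX : 0 ≤ a ^ 2 := sq_nonneg a
    have hY : 0 ≤ m * b ^ 2 := by positivity
    have h1 : (a ^ 2) ^ 3 * (247 * (m * b ^ 2)) ≤
        (a ^ 2) ^ 4 + (247 * (m * b ^ 2)) ^ 4 := by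
      generalize a ^ 2 = X at *
      generalize 247 * (m * b ^ 2) = Z at *
      rcases le_total Z X with h | h
      · nlinarith [mul_le_mul_of_nonneg_left h (pow_nonneg hX 3), sq_nonneg (Z ^ 2)]
      · nlinarith [mul_le_mul_of_nonneg_right (pow_le_pow_left₀ hX h 3) (hX.trans h),
          sq_nonneg (X ^ 2)]
    have h2 := mul_le_mul_of_nonneg_left h1 (by positivity : 0 ≤ 1 / m)
    calc 247 * (a ^ 6 * b ^ 2) = 1 / m * ((a ^ 2) ^ 3 * (247 * (m * b ^ 2))) := by
          field_simp
      _ ≤ _ := h2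
      _ = _ := by field_simp
  have h3 : b ^ 8 ≤ m ^ 3 * b ^ 8 :=
    le_mul_of_one_le_left (by positivity) (one_le_pow₀ hm)
  unfold momentConst
  nlinarith

lemma abs_pow_le_one_add {x : ℝ} {j k : ℕ} (h : j ≤ k) : |x| ^ j ≤ 1 + |x| ^ k := by
  rcases le_total |x| 1 with h1 | h1
  · have := pow_le_one₀ (n := j) (abs_nonneg x) h1
    have := pow_nonneg (abs_nonneg x) k
    linarith
  · have := pow_le_pow_right₀ h1 h
    linarith

lemma abs_pow_eight (x : ℝ) : |x| ^ 8 = x ^ 8 := by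
  rw [← abs_pow]; exact abs_of_nonneg (by positivity)

lemma abs_pow_le_one_add_pow_eight {x : ℝ} {j : ℕ} (h : j ≤ 8) : |x| ^ j ≤ 1 + x ^ 8 := by
  rw [← abs_pow_eight]; exact abs_pow_le_one_add h

section

variable {Ω : Type*} [MeasurableSpace Ω] {P : Measure Ω}

lemma integrable_pow_eight_of_moment8 {Y : Ω → ℝ} {B : ℝ} (hB : 0 ≤ B) (hY : Measurable Y)
    (h : moment8 P Y ≤ ENNReal.ofReal B) :
    Integrable (fun ω => Y ω ^ 8) P ∧ ∫ ω, Y ω ^ 8 ∂P ≤ B := by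
  have hm : AEStronglyMeasurable (fun ω => Y ω ^ 8) P := (hY.pow_const 8).aestronglyMeasurable
  have e : ∫⁻ ω, ENNReal.ofReal (Y ω ^ 8) ∂P = moment8 P Y := by
    refine lintegral_congr fun ω => ?_
    rw [← Real.enorm_of_nonneg (by positivity), enorm_pow]
  constructor
  · refine ⟨hm, ?_⟩
    rw [hasFiniteIntegral_iff_ofReal (ae_of_all _ fun ω => by positivity), e]
    exact h.trans_lt ENNReal.ofReal_lt_top
  · rw [integral_eq_lintegral_of_nonneg_ae (ae_of_all _ fun ω => by positivity) hm, e]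
    exact ENNReal.toReal_le_of_le_ofReal hB h

lemma integrable_pow_of_pow_eight [IsFiniteMeasure P] {Y : Ω → ℝ} (hY : Measurable Y)
    (h : Integrable (fun ω => Y ω ^ 8) P) {j : ℕ} (hj : j ≤ 8) :
    Integrable (fun ω => Y ω ^ j) P :=
  ((integrable_const (1 : ℝ)).add h).mono' (hY.pow_const j).aestronglyMeasurable
    (ae_of_all _ fun ω => by rw [norm_pow]; exact abs_pow_le_one_add_pow_eight hj)

lemma integrable_of_pow_eight [IsFiniteMeasure P] {Y : Ω → ℝ} (hY : Measurable Y)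
    (h : Integrable (fun ω => Y ω ^ 8) P) : Integrable Y P := by
  simpa using integrable_pow_of_pow_eight hY h (j := 1) (by norm_num)

lemma integrable_add_pow_eight {Y Z : Ω → ℝ} (hY : Measurable Y) (hZ : Measurable Z)
    (h1 : Integrable (fun ω => Y ω ^ 8) P) (h2 : Integrable (fun ω => Z ω ^ 8) P) :
    Integrable (fun ω => (Y ω + Z ω) ^ 8) P := by
  refine ((h1.add h2).const_mul (2 ^ 7)).mono' ((hY.add hZ).pow_const 8).aestronglyMeasurable
    (ae_of_all _ fun ω => ?_)
  rw [Real.norm_of_nonneg (by positivity), ← abs_pow_eight]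
  refine (pow_le_pow_left₀ (abs_nonneg _) (abs_add_le _ _) 8).trans ?_
  refine (add_pow_le (abs_nonneg _) (abs_nonneg _) 8).trans ?_
  simp [abs_pow_eight]

variable [IsProbabilityMeasure P]

/-- The eighth moment of a sum of `n` independent centered variables is `O(n⁴)`. -/
theorem integral_sum_pow_eight_le {Y : ℕ → Ω → ℝ} {B : ℝ} (hm : ∀ k, Measurable (Y k))
    (hind : iIndepFun Y P) (h8 : ∀ k, Integrable (fun ω => Y k ω ^ 8) P)
    (hB : ∀ k, ∫ ω, Y k ω ^ 8 ∂P ≤ B) (h0 : ∀ k, ∫ ω, Y k ω ∂P = 0) (n : ℕ) :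
    Integrable (fun ω => (∑ k ∈ Finset.range n, Y k ω) ^ 8) P ∧
      ∫ ω, (∑ k ∈ Finset.range n, Y k ω) ^ 8 ∂P ≤ momentConst * B * (n : ℝ) ^ 4 := by
  have hB0 : 0 ≤ B := (integral_nonneg fun ω => by positivity).trans (hB 0)
  have hK : 1 ≤ momentConst := by norm_num [momentConst]
  induction n with
  | zero => simp
  | succ n ih =>
    have hS : Measurable fun ω => ∑ k ∈ Finset.range n, Y k ω :=
      Finset.measurable_sum _ fun k _ => hm k
    simp_rw [Finset.sum_range_succ]
    refine ⟨integrable_add_pow_eight hS (hm n) ih.1 (h8 n), ?_⟩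
    -- The weight in Young's inequality is n and has to be at least 1, so the first summand is
    -- treated apart.
    rcases Nat.eq_zero_or_pos n with rfl | hn
    · simp only [Finset.range_zero, Finset.sum_empty, zero_add, Nat.cast_one, one_pow, mul_one]
      exact (hB 0).trans (le_mul_of_one_le_left hB0 hK)
    have hn1 : (1 : ℝ) ≤ n := by exact_mod_cast hn
    have hI : IndepFun (fun ω => ∑ k ∈ Finset.range n, Y k ω) (Y n) P := by
      have := hind.indepFun_finsetSum_of_notMem hm (i := n) (s := Finset.range n) (by simp)
      convert this using 1
      ext ω; simp
    have hI7 := hI.comp (measurable_id.pow_const 7) measurable_id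
    -- The linear term factors by independence and vanishes because the new summand is centered.
    have e7 : ∫ ω, (∑ k ∈ Finset.range n, Y k ω) ^ 7 * Y n ω ∂P = 0 := by
      have := hI7.integral_mul_eq_mul_integral
        (hS.pow_const 7).aestronglyMeasurable (hm n).aestronglyMeasurable
      refine (Eq.trans ?_ this).trans ?_
      · rfl
      · have : ∫ ω, (id ∘ Y n) ω ∂P = 0 := h0 n
        rw [this, mul_zero]
    have i7 : Integrable (fun ω => (∑ k ∈ Finset.range n, Y k ω) ^ 7 * Y n ω) P :=
      hI7.integrable_mul (integrable_pow_of_pow_eight hS ih.1 (by norm_num))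
        (integrable_of_pow_eight (hm n) (h8 n))
    have hle := integral_mono
      (integrable_add_pow_eight hS (hm n) ih.1 (h8 n))
      (((ih.1.const_mul (1 + 1 / (n : ℝ))).add (i7.const_mul 8)).add
        ((h8 n).const_mul (momentConst * (n : ℝ) ^ 3)))
      fun ω => add_pow_eight_le_of_one_le (∑ k ∈ Finset.range n, Y k ω) (Y n ω) hn1
    refine hle.trans ?_
    rw [integral_add' ((ih.1.const_mul _).add (i7.const_mul 8)) ((h8 n).const_mul _),
      integral_add' (ih.1.const_mul _) (i7.const_mul 8), integral_const_mul, integral_const_mul,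
      integral_const_mul, e7, mul_zero, add_zero]
    have hpos : 0 ≤ 1 + 1 / (n : ℝ) := by positivity
    have g1 := mul_le_mul_of_nonneg_left ih.2 hpos
    have g2 := mul_le_mul_of_nonneg_left (hB n)
      (by positivity : 0 ≤ momentConst * (n : ℝ) ^ 3)
    refine (add_le_add g1 g2).trans ?_
    have e : (1 + 1 / (n : ℝ)) * (momentConst * B * (n : ℝ) ^ 4) + momentConst * (n : ℝ) ^ 3 * B =
        momentConst * B * ((n : ℝ) ^ 3 * (n + 2)) := by
      field_simp; ring
    rw [e]
    refine mul_le_mul_of_nonneg_left ?_ (by positivity)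
    push_cast
    nlinarith [pow_nonneg (by linarith : (0 : ℝ) ≤ n) 3, sq_nonneg (n : ℝ)]

end

/-! ### Negative moments of sums of nonnegative variables -/

/-- Since exp x ≥ 1 + x + x²/2, it is enough that (1 + x + x²/2)(1 - x + x²/2) = 1 + x⁴/4 ≥ 1. -/
lemma exp_neg_le_quadratic {x : ℝ} (hx : 0 ≤ x) : Real.exp (-x) ≤ 1 - x + x ^ 2 / 2 := by
  rw [Real.exp_neg, inv_le_iff_one_le_mul₀ (Real.exp_pos x)]
  have h1 := Real.quadratic_le_exp_of_nonneg hx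
  have h2 : 0 ≤ 1 - x + x ^ 2 / 2 := by nlinarith [sq_nonneg (x - 1)]
  nlinarith [mul_le_mul_of_nonneg_left h1 h2, sq_nonneg (x ^ 2)]

section

variable {Ω : Type*} [MeasurableSpace Ω] {P : Measure Ω} [IsProbabilityMeasure P]

lemma integrable_exp_neg_mul {Y : Ω → ℝ} (hm : Measurable Y) (h0 : ∀ ω, 0 ≤ Y ω) {c : ℝ}
    (hc : 0 ≤ c) : Integrable (fun ω => Real.exp (-c * Y ω)) P := by
  refine (integrable_const (1 : ℝ)).mono' (by fun_prop) (ae_of_all _ fun ω => ?_)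
  rw [Real.norm_of_nonneg (Real.exp_pos _).le, Real.exp_le_one_iff]
  nlinarith [mul_nonneg hc (h0 ω)]

lemma mgf_neg_le {Y : Ω → ℝ} {M c : ℝ} (hm : Measurable Y) (h0 : ∀ ω, 0 ≤ Y ω)
    (hi : Integrable Y P) (hi2 : Integrable (fun ω => Y ω ^ 2) P) (h1 : ∫ ω, Y ω ∂P = 1)
    (h2 : ∫ ω, Y ω ^ 2 ∂P ≤ M) (hc : 0 ≤ c) :
    mgf Y P (-c) ≤ Real.exp (-c + c ^ 2 * M / 2) := by
  have hle : mgf Y P (-c) ≤ ∫ ω, (1 - c * Y ω + c ^ 2 / 2 * Y ω ^ 2) ∂P := by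
    refine integral_mono (integrable_exp_neg_mul hm h0 hc)
      (((integrable_const 1).sub (hi.const_mul c)).add (hi2.const_mul _)) fun ω => ?_
    have := exp_neg_le_quadratic (mul_nonneg hc (h0 ω))
    simp only
    rw [neg_mul]
    calc _ ≤ _ := this
      _ = _ := by ring
  have i1 : Integrable (fun _ : Ω => (1 : ℝ)) P := integrable_const 1
  have i2 : Integrable (fun ω => 1 - c * Y ω) P := i1.sub (hi.const_mul c)
  rw [integral_add i2 (hi2.const_mul _), integral_sub i1 (hi.const_mul c),
    integral_const_mul, integral_const_mul, h1] at hle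
  simp only [integral_const, probReal_univ, smul_eq_mul, mul_one] at hle
  have h3 := Real.add_one_le_exp (-c + c ^ 2 * M / 2)
  nlinarith [mul_le_mul_of_nonneg_left h2 (by positivity : 0 ≤ c ^ 2 / 2)]

/-- If R ≥ s, then (U + R)⁻⁸ ≤ s⁻⁸. Otherwise it is at most U⁻⁸, which may be multiplied by the
Chernoff weight exp(c(s - R)) ≥ 1; independence then factors the expectation. -/
lemma negMoment8_add_le {U R : Ω → ℝ} (hU : Measurable U) (hR : Measurable R)
    (hU0 : ∀ ω, 0 ≤ U ω) (hR0 : ∀ ω, 0 ≤ R ω) (hUR : IndepFun U R P) {c s : ℝ} (hs : 0 < s)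
    (hc : 0 ≤ c) :
    negMoment8 P (fun ω => U ω + R ω) ≤ ENNReal.ofReal ((s ^ 8)⁻¹) +
      negMoment8 P U * ENNReal.ofReal (Real.exp (c * s) * mgf R P (-c)) := by
  have hb : ∀ ω, (‖U ω + R ω‖ₑ ^ 8)⁻¹ ≤ ENNReal.ofReal ((s ^ 8)⁻¹) +
      (‖U ω‖ₑ ^ 8)⁻¹ * ENNReal.ofReal (Real.exp (c * (s - R ω))) := by
    intro ω
    rw [Real.enorm_of_nonneg (add_nonneg (hU0 ω) (hR0 ω))]
    rcases le_total s (R ω) with h | h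
    · refine le_add_right ?_
      rw [ENNReal.ofReal_inv_of_pos (by positivity), ENNReal.inv_le_inv, ENNReal.ofReal_pow hs.le]
      exact pow_le_pow_left₀ (by simp) (ENNReal.ofReal_le_ofReal (by linarith [hU0 ω])) 8
    · refine le_add_left ?_
      have h1 : (1 : ℝ≥0∞) ≤ ENNReal.ofReal (Real.exp (c * (s - R ω))) := by
        rw [ENNReal.one_le_ofReal, Real.one_le_exp_iff]
        exact mul_nonneg hc (by linarith)
      refine le_trans ?_ (le_mul_of_one_le_right (by simp) h1)
      rw [ENNReal.inv_le_inv, Real.enorm_of_nonneg (hU0 ω)]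
      exact pow_le_pow_left₀ (by simp) (ENNReal.ofReal_le_ofReal (by linarith [hR0 ω])) 8
  have hexp : ∫⁻ ω, ENNReal.ofReal (Real.exp (c * (s - R ω))) ∂P =
      ENNReal.ofReal (Real.exp (c * s) * mgf R P (-c)) := by
    have e : ∀ ω, Real.exp (c * (s - R ω)) = Real.exp (c * s) * Real.exp (-c * R ω) := by
      intro ω; rw [← Real.exp_add]; ring_nf
    simp_rw [e]
    rw [← ofReal_integral_eq_lintegral_ofReal ((integrable_exp_neg_mul hR hR0 hc).const_mul _)
      (ae_of_all _ fun ω => by positivity), integral_const_mul]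
    rfl
  have hmU : Measurable fun x : ℝ => (‖x‖ₑ ^ 8)⁻¹ := by fun_prop
  have hmR : Measurable fun x : ℝ => ENNReal.ofReal (Real.exp (c * (s - x))) := by fun_prop
  calc negMoment8 P (fun ω => U ω + R ω)
      ≤ ∫⁻ ω, (ENNReal.ofReal ((s ^ 8)⁻¹) +
          (‖U ω‖ₑ ^ 8)⁻¹ * ENNReal.ofReal (Real.exp (c * (s - R ω)))) ∂P := lintegral_mono hb
    _ = ENNReal.ofReal ((s ^ 8)⁻¹) +
          ∫⁻ ω, (‖U ω‖ₑ ^ 8)⁻¹ * ENNReal.ofReal (Real.exp (c * (s - R ω))) ∂P := by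
        rw [lintegral_add_left measurable_const]
        simp
    _ = _ := by
        have := lintegral_mul_eq_lintegral_mul_lintegral_of_indepFun (hmU.comp hU) (hmR.comp hR)
          (hUR.comp hmU hmR)
        rw [← hexp]
        congr 1

/-- Uniform negative moments of normalized sums of independent nonnegative variables. -/
theorem exists_negMoment8_sum_le {Y : ℕ → Ω → ℝ} {M : ℝ} {n₀ : ℕ} (hm : ∀ k, Measurable (Y k))
    (hind : iIndepFun Y P) (hpos : ∀ k ω, 0 ≤ Y k ω) (hi : ∀ k, Integrable (Y k) P)
    (hi2 : ∀ k, Integrable (fun ω => Y k ω ^ 2) P) (h1 : ∀ k, ∫ ω, Y k ω ∂P = 1)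
    (h2 : ∀ k, ∫ ω, Y k ω ^ 2 ∂P ≤ M)
    (h : negMoment8 P (fun ω => ∑ k ∈ Finset.range n₀, Y k ω) < ∞) :
    ∃ K < ∞, ∀ n ≥ n₀,
      ENNReal.ofReal ((n : ℝ) ^ 8) * negMoment8 P (fun ω => ∑ k ∈ Finset.range n, Y k ω) ≤ K := by
  set N := negMoment8 P (fun ω => ∑ k ∈ Finset.range n₀, Y k ω) with hN
  set L := max M 1 with hL
  have hL1 : 1 ≤ L := le_max_right _ _
  have hL0 : 0 < L := by linarith
  -- With m = n - n₀ ≥ 1 one has n ≤ (n₀ + 1)m. `C₁` bounds n⁸(m/2)⁻⁸, and `C₂` bounds n⁸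
  -- exp(-m/(8L)) through exp x ≥ x⁸/8!. The case n = n₀ is covered by the first summand of the
  -- bound below.
  set C₁ : ℝ := 2 ^ 8 * (n₀ + 1) ^ 8
  set C₂ : ℝ := (8 * L) ^ 8 * Nat.factorial 8 * (n₀ + 1) ^ 8
  refine ⟨ENNReal.ofReal ((n₀ : ℝ) ^ 8) * N + (ENNReal.ofReal C₁ + N * ENNReal.ofReal C₂),
    ?_, fun n hn => ?_⟩
  · exact ENNReal.add_lt_top.2 ⟨ENNReal.mul_lt_top ENNReal.ofReal_lt_top h,
      ENNReal.add_lt_top.2 ⟨ENNReal.ofReal_lt_top, ENNReal.mul_lt_top h ENNReal.ofReal_lt_top⟩⟩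
  rcases eq_or_lt_of_le hn with rfl | hlt
  · exact le_add_right le_rfl
  refine le_add_left ?_
  set m : ℕ := n - n₀ with hmdef
  have hm0 : 0 < m := Nat.sub_pos_of_lt hlt
  have hm1 : (1 : ℝ) ≤ m := by exact_mod_cast hm0
  have hnm : (n : ℝ) = n₀ + m := by
    rw [hmdef, Nat.cast_sub hn]; ring
  have hnle : (n : ℝ) ≤ (n₀ + 1) * m := by
    rw [hnm]; nlinarith [(Nat.cast_nonneg n₀ : (0 : ℝ) ≤ n₀)]
  have hdisj : Disjoint (Finset.range n₀) (Finset.Ico n₀ n) := by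
    rw [Finset.disjoint_left]; intro k hk hk'
    simp only [Finset.mem_range, Finset.mem_Ico] at hk hk'; omega
  have hsplit : ∀ ω, ∑ k ∈ Finset.range n, Y k ω =
      (∑ k ∈ Finset.range n₀, Y k ω) + ∑ k ∈ Finset.Ico n₀ n, Y k ω := fun ω =>
    (Finset.sum_range_add_sum_Ico (fun k => Y k ω) hn).symm
  have hIS : IndepFun (fun ω => ∑ k ∈ Finset.range n₀, Y k ω)
      (fun ω => ∑ k ∈ Finset.Ico n₀ n, Y k ω) P := by
    have hI := hind.indepFun_finset _ _ hdisj hm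
    have hsum : ∀ s : Finset ℕ, Measurable fun f : s → ℝ => ∑ k : s, f k := fun s =>
      Finset.measurable_sum _ fun k _ => measurable_pi_apply k
    have := hI.comp (hsum _) (hsum _)
    convert this using 1
    · ext ω
      exact (Finset.sum_coe_sort (Finset.range n₀) fun k => Y k ω).symm
    · ext ω
      exact (Finset.sum_coe_sort (Finset.Ico n₀ n) fun k => Y k ω).symm
  have hmgf : mgf (fun ω => ∑ k ∈ Finset.Ico n₀ n, Y k ω) P (-(1 / (2 * L))) ≤
      Real.exp (-(3 / (8 * L)) * m) := by
    have e : (fun ω => ∑ k ∈ Finset.Ico n₀ n, Y k ω) = ∑ k ∈ Finset.Ico n₀ n, Y k := by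
      ext ω; simp
    rw [e, hind.mgf_sum hm]
    have hk : ∀ k ∈ Finset.Ico n₀ n, mgf (Y k) P (-(1 / (2 * L))) ≤ Real.exp (-(3 / (8 * L))) := by
      intro k _
      refine (mgf_neg_le (hm k) (hpos k) (hi k) (hi2 k) (h1 k) ((h2 k).trans (le_max_left M 1))
        (by positivity)).trans (le_of_eq ?_)
      congr 1
      rw [← hL]
      field_simp
      ring
    refine (Finset.prod_le_prod (fun k _ => mgf_nonneg) hk).trans (le_of_eq ?_)
    rw [Finset.prod_const, Nat.card_Ico, ← Real.exp_nat_mul]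
    congr 1
    rw [← hmdef]; ring
  -- The m later summands have total mean m, so s is half of it. The value c = 1/(2L) gives each
  -- factor of the generating function the exponent -1/(2L) + 1/(8L) = -3/(8L) at most, and the
  -- total exponent is m/(4L) - 3m/(8L) = -m/(8L).
  have key := negMoment8_add_le (P := P) (s := (m : ℝ) / 2) (c := 1 / (2 * L))
    (Finset.measurable_sum (Finset.range n₀) fun k _ => hm k)
    (Finset.measurable_sum (Finset.Ico n₀ n) fun k _ => hm k)
    (fun ω => Finset.sum_nonneg fun k _ => hpos k ω)
    (fun ω => Finset.sum_nonneg fun k _ => hpos k ω) hIS (by positivity) (by positivity)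
  simp_rw [hsplit]
  refine (mul_le_mul_of_nonneg_left key (by simp)).trans ?_
  rw [mul_add, mul_left_comm, ← ENNReal.ofReal_mul (by positivity),
    ← ENNReal.ofReal_mul (by positivity)]
  have hn8 : (n : ℝ) ^ 8 ≤ (n₀ + 1) ^ 8 * m ^ 8 := by
    rw [← mul_pow]; exact pow_le_pow_left₀ (by positivity) hnle 8
  refine add_le_add (ENNReal.ofReal_le_ofReal ?_)
    (mul_le_mul_of_nonneg_left (ENNReal.ofReal_le_ofReal ?_) (by simp))
  · rw [← div_eq_mul_inv, div_le_iff₀ (by positivity), div_pow]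
    calc (n : ℝ) ^ 8 ≤ (n₀ + 1) ^ 8 * m ^ 8 := hn8
      _ = _ := by simp only [C₁]; field_simp
  · have hx : 0 ≤ (m : ℝ) / (8 * L) := by positivity
    have he := Real.pow_div_factorial_le_exp _ hx 8
    have hexp : Real.exp (1 / (2 * L) * (m / 2)) *
        mgf (fun ω => ∑ k ∈ Finset.Ico n₀ n, Y k ω) P (-(1 / (2 * L))) ≤
        (Real.exp (m / (8 * L)))⁻¹ := by
      refine (mul_le_mul_of_nonneg_left hmgf (Real.exp_pos _).le).trans (le_of_eq ?_)
      rw [← Real.exp_add, ← Real.exp_neg]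
      congr 1
      field_simp
      ring
    have hinv : (Real.exp (m / (8 * L)))⁻¹ ≤ ((m / (8 * L)) ^ 8 / Nat.factorial 8)⁻¹ :=
      inv_anti₀ (by positivity) he
    refine (mul_le_mul hn8 (hexp.trans hinv) (mul_nonneg (Real.exp_pos _).le mgf_nonneg)
      (by positivity)).trans (le_of_eq ?_)
    simp only [C₂]
    rw [inv_div, div_pow]
    field_simp

end

/-! ### Deterministic estimates -/

/-- The square has degree 6, so the eighth power of the largest factor dominates it up to the
additive 1. This is why eighth moments are enough. -/
lemma sq_mul_mul_le {x y z : ℝ} (hx : 0 ≤ x) (hy : 0 ≤ y) (hz : 0 ≤ z) :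
    (x * y * z) ^ 2 ≤ 1 + (x ^ 8 + y ^ 8 + z ^ 8) := by
  set m := max x (max y z) with hm
  have hxm : x ≤ m := le_max_left _ _
  have hym : y ≤ m := (le_max_left _ _).trans (le_max_right _ _)
  have hzm : z ≤ m := (le_max_right _ _).trans (le_max_right _ _)
  have hm0 : 0 ≤ m := hx.trans hxm
  have h1 : x * y * z ≤ m * m * m := by gcongr
  have h2 : (x * y * z) ^ 2 ≤ m ^ 6 := by
    calc (x * y * z) ^ 2 ≤ (m * m * m) ^ 2 := pow_le_pow_left₀ (by positivity) h1 2
      _ = m ^ 6 := by ring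
  have h3 : m ^ 6 ≤ 1 + m ^ 8 := by
    have := abs_pow_le_one_add (x := m) (show 6 ≤ 8 by norm_num)
    rwa [abs_of_nonneg hm0] at this
  have h4 : m ^ 8 ≤ x ^ 8 + y ^ 8 + z ^ 8 := by
    have hx8 := pow_nonneg hx 8
    have hy8 := pow_nonneg hy 8
    have hz8 := pow_nonneg hz 8
    rcases max_choice x (max y z) with h | h
    · rw [hm, h]; linarith
    · rcases max_choice y z with h' | h'
      · rw [hm, h, h']; linarith
      · rw [hm, h, h']; linarith
  linarith

/-- In the application x, w, d, a, t are |S|/√n, |T - n|/√n, |∇⁻¹|, |Q|/n and T/n. Cauchy–Schwarz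
over seven terms gives the factor 7; the constant 98 is not sharp. -/
lemma sq_polynomial_le {x w d a t : ℝ} (hx : 0 ≤ x) (hw : 0 ≤ w) (hd : 0 ≤ d)
    (ht : 0 ≤ t) :
    (x * d + x * x * d + x * w * d + (x * x + 1) + a * d ^ 2 + t ^ 2 * d ^ 2) ^ 2 ≤
      98 * (1 + x ^ 8 + w ^ 8 + d ^ 8 + a ^ 4 + t ^ 8) := by
  have s1 := sq_mul_mul_le hx hd zero_le_one
  have s2 := sq_mul_mul_le hx hx hd
  have s3 := sq_mul_mul_le hx hw hd
  have s4 := sq_mul_mul_le hx hx zero_le_one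
  have s5 : (a * d ^ 2) ^ 2 ≤ a ^ 4 + d ^ 8 := by
    nlinarith [sq_nonneg (a ^ 2 - d ^ 4), sq_nonneg (a ^ 2), sq_nonneg (d ^ 4)]
  have s6 : (t ^ 2 * d ^ 2) ^ 2 ≤ t ^ 8 + d ^ 8 := by
    nlinarith [sq_nonneg (t ^ 4 - d ^ 4), sq_nonneg (t ^ 4), sq_nonneg (d ^ 4)]
  have hx8 := pow_nonneg hx 8
  have hw8 := pow_nonneg hw 8
  have hd8 := pow_nonneg hd 8
  have ht8 := pow_nonneg ht 8
  have ha4 : 0 ≤ a ^ 4 := by positivity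
  simp only [mul_one, one_pow] at s1 s4
  have cs : ∀ e₁ e₂ e₃ e₄ e₅ e₆ : ℝ, (e₁ + e₂ + e₃ + (e₄ + 1) + e₅ + e₆) ^ 2 ≤
      7 * (e₁ ^ 2 + e₂ ^ 2 + e₃ ^ 2 + e₄ ^ 2 + 1 + e₅ ^ 2 + e₆ ^ 2) := by
    intro e₁ e₂ e₃ e₄ e₅ e₆
    have := sq_sum_le_card_mul_sum_sq (s := Finset.univ) (f := ![e₁, e₂, e₃, e₄, 1, e₅, e₆])
    simp only [Fin.sum_univ_succ, Finset.card_univ, Fintype.card_fin] at this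
    simp at this
    calc _ = (e₁ + (e₂ + (e₃ + (e₄ + (1 + (e₅ + e₆)))))) ^ 2 := by ring
      _ ≤ _ := this
      _ = _ := by ring
  refine (cs _ _ _ _ _ _).trans ?_
  nlinarith

/-- The difference between a smooth statistic and its Stein weight, in the normalization in which it
is of order one. -/
lemma sq_stein_error_le {K n s t q v y ρ g₀ g g₂ : ℝ} (hK : 1 ≤ K) (hn : 1 ≤ n) (ht : 0 < t)
    (hg₀0 : g₀ ≠ 0) (hg0 : g ≠ 0) (hg₀ : |g₀| ≤ K) (hg : |g| ≤ K) (hg₂ : |g₂| ≤ K)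
    (hv0 : 0 ≤ v) (hv : v ≤ K ^ 2) (hgg : |g - g₀| ≤ K * (|s| / n))
    (hvg : √n * |v - g₀ ^ 2| ≤ K) (hρ : n * |ρ| ≤ K * ((s / √n) ^ 2 + 1))
    (hy : y = g₀ * (s / n) + ρ) :
    (n * y - v * n * (s / t + q / t ^ 2) / g - v * g₂ / g ^ 2) ^ 2 ≤
      98 * K ^ 10 * (1 + (s / √n) ^ 8 + ((t - n) / √n) ^ 8 + ((g₀ * g / n * t)⁻¹) ^ 8 +
        (q / n) ^ 4 + (t / n) ^ 8) := by
  have hn0 : 0 < n := by linarith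
  have hr : 0 < √n := Real.sqrt_pos.2 hn0
  have hrr : √n * √n = n := Real.mul_self_sqrt hn0.le
  set r := √n with hrdef
  set x := |s / r| with hx
  set w := |(t - n) / r| with hw
  set d := |(g₀ * g / n * t)⁻¹| with hd
  set a := |q / n| with ha
  have hx0 : 0 ≤ x := abs_nonneg _
  have hw0 : 0 ≤ w := abs_nonneg _
  have hd0 : 0 ≤ d := abs_nonneg _
  have ha0 : 0 ≤ a := abs_nonneg _
  have htn : 0 ≤ t / n := by positivity
  have hK0 : 0 ≤ K := by linarith
  have hKp : ∀ i : ℕ, i ≤ 5 → K ^ i ≤ K ^ 5 := fun i hi => pow_le_pow_right₀ hK hi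
  -- The cancellation. With D = (g₀ g t/n)⁻¹ one has 1/(t g) = g₀D/n, so the leading part g₀s - v n
  -- s/(t g) equals s g₀ D (g₀ g t/n - v). The bracket splits into the deviations of t from n, of g
  -- from g₀ and of v from g₀², each of order n^(-1/2); writing s = √n (s/√n) absorbs this.
  have dec : n * y - v * n * (s / t + q / t ^ 2) / g - v * g₂ / g ^ 2 =
      (s / r) * g₀ * (g₀ * g / n * t)⁻¹ *
        (g₀ * g * ((t - n) / r) + r * (g₀ * (g - g₀)) - r * (v - g₀ ^ 2)) + n * ρ -
      v * (q / n) * g₀ ^ 2 * g * (g₀ * g / n * t)⁻¹ ^ 2 -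
      v * g₂ * g₀ ^ 2 * (t / n) ^ 2 * (g₀ * g / n * t)⁻¹ ^ 2 := by
    rw [hy, ← hrr]
    have := ht.ne'
    have := hr.ne'
    field_simp
    ring
  have b0 : |g₀ * g * ((t - n) / r) + r * (g₀ * (g - g₀)) - r * (v - g₀ ^ 2)| ≤
      K ^ 2 * (1 + x + w) := by
    have c1 : |g₀ * g * ((t - n) / r)| ≤ K ^ 2 * w := by
      rw [abs_mul, abs_mul, sq]
      exact mul_le_mul_of_nonneg_right (mul_le_mul hg₀ hg (abs_nonneg _) hK0) hw0
    have c2 : |r * (g₀ * (g - g₀))| ≤ K ^ 2 * x := by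
      rw [abs_mul, abs_mul, abs_of_pos hr]
      calc r * (|g₀| * |g - g₀|) ≤ r * (K * (K * (|s| / n))) := by gcongr
        _ = K ^ 2 * x := by
          rw [hx, abs_div, abs_of_pos hr, ← hrr]
          field_simp
    have c3 : |r * (v - g₀ ^ 2)| ≤ K ^ 2 := by
      rw [abs_mul, abs_of_pos hr]
      exact hvg.trans (le_self_pow₀ hK two_ne_zero)
    refine (abs_sub _ _).trans ?_
    have := abs_add_le (g₀ * g * ((t - n) / r)) (r * (g₀ * (g - g₀)))
    linarith
  have t1 : |(s / r) * g₀ * (g₀ * g / n * t)⁻¹ *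
        (g₀ * g * ((t - n) / r) + r * (g₀ * (g - g₀)) - r * (v - g₀ ^ 2))| ≤
      K ^ 5 * (x * d + x * x * d + x * w * d) := by
    rw [abs_mul, abs_mul, abs_mul]
    calc x * |g₀| * d * _ ≤ x * K * d * (K ^ 2 * (1 + x + w)) := by gcongr
      _ = K ^ 3 * (x * d + x * x * d + x * w * d) := by ring
      _ ≤ _ := mul_le_mul_of_nonneg_right (hKp 3 (by norm_num)) (by positivity)
  have t2 : |n * ρ| ≤ K ^ 5 * (x * x + 1) := by
    rw [abs_mul, abs_of_pos hn0]
    refine hρ.trans ?_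
    rw [← sq_abs (s / r), ← hx, sq]
    exact mul_le_mul_of_nonneg_right (le_self_pow₀ hK (by norm_num)) (by positivity)
  have t3 : |v * (q / n) * g₀ ^ 2 * g * (g₀ * g / n * t)⁻¹ ^ 2| ≤ K ^ 5 * (a * d ^ 2) := by
    rw [abs_mul, abs_mul, abs_mul, abs_mul, abs_pow, abs_pow, abs_of_nonneg hv0]
    calc v * a * |g₀| ^ 2 * |g| * d ^ 2 ≤ K ^ 2 * a * K ^ 2 * K * d ^ 2 := by gcongr
      _ = _ := by ring
  have t4 : |v * g₂ * g₀ ^ 2 * (t / n) ^ 2 * (g₀ * g / n * t)⁻¹ ^ 2| ≤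
      K ^ 5 * ((t / n) ^ 2 * d ^ 2) := by
    rw [abs_mul, abs_mul, abs_mul, abs_mul, abs_pow, abs_pow, abs_pow, abs_of_nonneg hv0,
      abs_of_nonneg htn]
    calc v * |g₂| * |g₀| ^ 2 * (t / n) ^ 2 * d ^ 2 ≤
        K ^ 2 * K * K ^ 2 * (t / n) ^ 2 * d ^ 2 := by gcongr
      _ = _ := by ring
  have tot : |n * y - v * n * (s / t + q / t ^ 2) / g - v * g₂ / g ^ 2| ≤
      K ^ 5 * (x * d + x * x * d + x * w * d + (x * x + 1) + a * d ^ 2 + (t / n) ^ 2 * d ^ 2) := by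
    rw [dec]
    refine (abs_sub _ _).trans ?_
    refine (add_le_add (abs_sub _ _) le_rfl).trans ?_
    refine (add_le_add (add_le_add (abs_add_le _ _) le_rfl) le_rfl).trans ?_
    linarith
  rw [← sq_abs]
  refine (pow_le_pow_left₀ (abs_nonneg _) tot 2).trans ?_
  rw [mul_pow]
  have := mul_le_mul_of_nonneg_left (sq_polynomial_le (a := a) hx0 hw0 hd0 htn)
    (by positivity : 0 ≤ (K ^ 5) ^ 2)
  refine this.trans (le_of_eq ?_)
  have e4 : a ^ 4 = (q / n) ^ 4 := by
    rw [ha, ← abs_pow]; exact abs_of_nonneg (by positivity)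
  rw [e4, hx, hw, hd, abs_pow_eight, abs_pow_eight, abs_pow_eight]
  ring

/-! ### Smooth functions with a derivative bounded away from zero -/

/-- A twice differentiable function with `c ≤ |H'| ≤ h₁` and `|H''| ≤ h₂`. -/
structure IsSmoothStatistic (H : ℝ → ℝ) (c h₁ h₂ : ℝ) : Prop where
  differentiable : Differentiable ℝ H
  differentiable_deriv : Differentiable ℝ (deriv H)
  pos : 0 < c
  le_abs_deriv : ∀ x, c ≤ |deriv H x|
  abs_deriv_le : ∀ x, |deriv H x| ≤ h₁
  abs_deriv_deriv_le : ∀ x, |deriv (deriv H) x| ≤ h₂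

namespace IsSmoothStatistic

variable {H : ℝ → ℝ} {c h₁ h₂ : ℝ}

lemma deriv_ne_zero (h : IsSmoothStatistic H c h₁ h₂) (x : ℝ) : deriv H x ≠ 0 := fun h0 => by
  have := h.le_abs_deriv x
  rw [h0, abs_zero] at this
  linarith [h.pos]

lemma nonneg₁ (h : IsSmoothStatistic H c h₁ h₂) : 0 ≤ h₁ :=
  (abs_nonneg _).trans (h.abs_deriv_le 0)

lemma nonneg₂ (h : IsSmoothStatistic H c h₁ h₂) : 0 ≤ h₂ :=
  (abs_nonneg _).trans (h.abs_deriv_deriv_le 0)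

lemma abs_deriv_sub_le (h : IsSmoothStatistic H c h₁ h₂) (x : ℝ) :
    |deriv H x - deriv H 0| ≤ h₂ * |x| := by
  have := convex_univ.norm_image_sub_le_of_norm_deriv_le (f := deriv H) (C := h₂)
    (fun y _ => h.differentiable_deriv y) (fun y _ => h.abs_deriv_deriv_le y)
    (mem_univ 0) (mem_univ x)
  simpa using this

lemma abs_sub_le (h : IsSmoothStatistic H c h₁ h₂) (x : ℝ) : |H x - H 0| ≤ h₁ * |x| := by
  have := convex_univ.norm_image_sub_le_of_norm_deriv_le (f := H) (C := h₁)
    (fun y _ => h.differentiable y) (fun y _ => h.abs_deriv_le y) (mem_univ 0) (mem_univ x)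
  simpa using this

/-- The mean value inequality for y ↦ H(y) - H'(0)y on the ball of radius |x|. No continuity of H''
is needed, at the cost of the factor 1/2. -/
lemma abs_taylor_le (h : IsSmoothStatistic H c h₁ h₂) (x : ℝ) :
    |H x - H 0 - deriv H 0 * x| ≤ h₂ * x ^ 2 := by
  have hd : ∀ y, HasDerivAt (fun y => H y - deriv H 0 * y) (deriv H y - deriv H 0) y := fun y =>
    ((h.differentiable y).hasDerivAt.sub ((hasDerivAt_id y).const_mul (deriv H 0))).congr_deriv
      (by rw [mul_one])
  have := (convex_closedBall (0 : ℝ) |x|).norm_image_sub_le_of_norm_hasDerivWithin_le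
    (C := h₂ * |x|) (fun y _ => (hd y).hasDerivWithinAt) (fun y hy => ?_)
    (x := 0) (y := x) (by simp) (by simp)
  · simp only [mul_zero, sub_zero, Real.norm_eq_abs] at this
    rw [← sq_abs, sq, ← mul_assoc]
    convert this using 2
    ring
  · refine (h.abs_deriv_sub_le y).trans (mul_le_mul_of_nonneg_left ?_ h.nonneg₂)
    simpa using hy

lemma measurable (h : IsSmoothStatistic H c h₁ h₂) : Measurable H :=
  h.differentiable.continuous.measurable

lemma injective (h : IsSmoothStatistic H c h₁ h₂) : Function.Injective H :=
  injective_of_hasDerivAt_ne_zero (fun x => (h.differentiable x).hasDerivAt) h.deriv_ne_zero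

end IsSmoothStatistic

/-! ### Moments of the sums -/

/-- A Stein sequence of unit variances, all of whose eighth moments are at most `b`. -/
structure IsBoundedSteinSequence {Ω : Type*} [MeasurableSpace Ω] (P : Measure Ω) (X : ℕ → Ω → ℝ)
    (p : ℕ → ℝ → ℝ) (b : ℝ) : Prop extends IsSteinSequence P X p where
  integral_sq : ∀ k, ∫ ω, X k ω ^ 2 ∂P = 1
  integrable_pow : ∀ k, Integrable (fun ω => X k ω ^ 8) P
  integral_pow_le : ∀ k, ∫ ω, X k ω ^ 8 ∂P ≤ b
  integrable_kernel_pow : ∀ k, Integrable (fun ω => steinKernel (p k) (X k ω) ^ 8) P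
  integral_kernel_pow_le : ∀ k, ∫ ω, steinKernel (p k) (X k ω) ^ 8 ∂P ≤ b
  integrable_deriv_pow : ∀ k, Integrable (fun ω => deriv (steinKernel (p k)) (X k ω) ^ 8) P
  integral_deriv_pow_le : ∀ k, ∫ ω, deriv (steinKernel (p k)) (X k ω) ^ 8 ∂P ≤ b

namespace IsBoundedSteinSequence

variable {Ω : Type*} [MeasurableSpace Ω] {P : Measure Ω} [IsProbabilityMeasure P]
  {X : ℕ → Ω → ℝ} {p : ℕ → ℝ → ℝ} {b : ℝ}

omit [IsProbabilityMeasure P] in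
lemma nonneg (h : IsBoundedSteinSequence P X p b) : 0 ≤ b :=
  (integral_nonneg fun ω => by positivity).trans (h.integral_pow_le 0)

omit [IsProbabilityMeasure P] in
lemma integral_eq_zero (h : IsBoundedSteinSequence P X p b) (k : ℕ) : ∫ ω, X k ω ∂P = 0 := by
  rw [← (h.density k).integral_id, integral_map (h.measurable k).aemeasurable (by fun_prop)]

lemma integrable (h : IsBoundedSteinSequence P X p b) (k : ℕ) : Integrable (X k) P :=
  integrable_of_pow_eight (h.measurable k) (h.integrable_pow k)

lemma integral_kernel (h : IsBoundedSteinSequence P X p b) (k : ℕ) :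
    ∫ ω, steinKernel (p k) (X k ω) ∂P = 1 := by
  have hm := (h.measurable k).aemeasurable (μ := P)
  have mτ := (h.density k).measurable_steinKernel
  rw [← h.integral_sq k, ← integral_map hm mτ.aestronglyMeasurable,
    ← integral_map (f := fun x => x ^ 2) hm (by fun_prop)]
  refine (h.density k).integral_steinKernel ?_ ?_
  · exact (integrable_map_measure mτ.aestronglyMeasurable hm).2 (h.integrable_kernel k)
  · exact (integrable_map_measure (by fun_prop) hm).2
      (integrable_pow_of_pow_eight (h.measurable k) (h.integrable_pow k) (by norm_num))

lemma partialSum_pow (h : IsBoundedSteinSequence P X p b) (n : ℕ) :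
    Integrable (fun ω => partialSum X n ω ^ 8) P ∧
      ∫ ω, partialSum X n ω ^ 8 ∂P ≤ momentConst * b * (n : ℝ) ^ 4 :=
  integral_sum_pow_eight_le h.measurable h.indep h.integrable_pow h.integral_pow_le
    h.integral_eq_zero n

/-- Each kernel has mean Var(X_k) = 1, so this is again a sum of independent centered variables; the
factor 2⁷ comes from convexity of the eighth power. -/
lemma steinSum_sub_pow (h : IsBoundedSteinSequence P X p b) (n : ℕ) :
    Integrable (fun ω => (steinSum X p n ω - n) ^ 8) P ∧
      ∫ ω, (steinSum X p n ω - n) ^ 8 ∂P ≤ momentConst * (2 ^ 7 * (b + 1)) * (n : ℝ) ^ 4 := by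
  have hi : ∀ k, Integrable (fun ω => (steinKernel (p k) (X k ω) - 1) ^ 8) P := fun k => by
    simpa only [sub_eq_add_neg] using integrable_add_pow_eight (h.measurable_kernel k)
      measurable_const (h.integrable_kernel_pow k) (integrable_const (((-1 : ℝ)) ^ 8))
  have hle : ∀ k, ∫ ω, (steinKernel (p k) (X k ω) - 1) ^ 8 ∂P ≤ 2 ^ 7 * (b + 1) := by
    intro k
    have h1 : ∀ x : ℝ, (x - 1) ^ 8 ≤ 2 ^ 7 * (x ^ 8 + 1) := fun x => by
      have := Even.add_pow_le (a := x) (b := -1) (n := 8) (by decide)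
      norm_num at this ⊢
      rw [sub_eq_add_neg]
      linarith
    refine (integral_mono (hi k) (((h.integrable_kernel_pow k).add
      (integrable_const (1 : ℝ))).const_mul (2 ^ 7)) fun ω => h1 _).trans ?_
    rw [integral_const_mul, integral_add' (h.integrable_kernel_pow k) (integrable_const _)]
    simpa using h.integral_kernel_pow_le k
  have hind : iIndepFun (fun k ω => steinKernel (p k) (X k ω) - 1) P :=
    h.indep.comp (fun k x => steinKernel (p k) x - 1)
      fun k => (h.density k).measurable_steinKernel.sub_const 1
  have := integral_sum_pow_eight_le (fun k => (h.measurable_kernel k).sub_const 1) hind hi hle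
    (fun k => by
      rw [integral_sub (h.integrable_kernel k) (integrable_const _), h.integral_kernel k]
      simp) n
  simpa [steinSum, Finset.sum_sub_distrib] using this

lemma integral_partialSum (h : IsBoundedSteinSequence P X p b) (n : ℕ) :
    ∫ ω, partialSum X n ω ∂P = 0 := by
  unfold partialSum
  rw [integral_finsetSum _ fun k _ => h.integrable k]
  exact Finset.sum_eq_zero fun k _ => h.integral_eq_zero k

lemma integral_partialSum_sq (h : IsBoundedSteinSequence P X p b) (n : ℕ) :
    ∫ ω, partialSum X n ω ^ 2 ∂P = n := by
  have hL : ∀ k, MemLp (X k) 2 P := fun k =>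
    (memLp_two_iff_integrable_sq (h.measurable k).aestronglyMeasurable).2
      (integrable_pow_of_pow_eight (h.measurable k) (h.integrable_pow k) (by norm_num))
  have hv : ∀ k, variance (X k) P = 1 := fun k => by
    rw [variance_of_integral_eq_zero (h.measurable k).aemeasurable (h.integral_eq_zero k),
      h.integral_sq k]
  have := IndepFun.variance_sum (s := Finset.range n) (fun k _ => hL k)
    (fun i _ j _ hij => h.indep.indepFun hij)
  have e : (∑ k ∈ Finset.range n, X k) = partialSum X n := by ext ω; simp [partialSum]
  rw [e, variance_of_integral_eq_zero (h.measurable_partialSum n).aemeasurable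
    (h.integral_partialSum n)] at this
  rw [this]
  simp [hv]

-- Convexity: the power of a mean is at most the mean of the powers. No cancellation is needed here.
omit [IsProbabilityMeasure P] in
lemma mean_pow (h : IsBoundedSteinSequence P X p b) {n : ℕ} (hn : 1 ≤ n) :
    Integrable (fun ω => (steinSum X p n ω / n) ^ 8) P ∧
      ∫ ω, (steinSum X p n ω / n) ^ 8 ∂P ≤ b := by
  have hn0 : (0 : ℝ) < n := by exact_mod_cast hn
  have hi : Integrable (fun ω => (∑ k ∈ Finset.range n, steinKernel (p k) (X k ω) ^ 8) / n) P :=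
    (integrable_finsetSum _ fun k _ => h.integrable_kernel_pow k).div_const _
  have hle : ∀ ω, (steinSum X p n ω / n) ^ 8 ≤
      (∑ k ∈ Finset.range n, steinKernel (p k) (X k ω) ^ 8) / n := by
    intro ω
    have := pow_sum_div_card_le_sum_pow (s := Finset.range n)
      (f := fun k => steinKernel (p k) (X k ω))
      (fun k _ => (h.density k).steinKernel_nonneg _) 7
    rw [Finset.card_range] at this
    rw [div_pow, le_div_iff₀ hn0]
    refine le_trans (le_of_eq ?_) this
    unfold steinSum
    field_simp
  have hint := hi.mono' (((h.measurable_steinSum n).div_const _).pow_const 8).aestronglyMeasurable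
    (ae_of_all _ fun ω => by rw [Real.norm_of_nonneg (by positivity)]; exact hle ω)
  refine ⟨hint, (integral_mono hint hi hle).trans ?_⟩
  rw [integral_div, integral_finsetSum _ fun k _ => h.integrable_kernel_pow k,
    div_le_iff₀ hn0]
  refine (Finset.sum_le_sum fun k _ => h.integral_kernel_pow_le k).trans (le_of_eq ?_)
  simp [mul_comm]

-- Convexity again, now only for the fourth power, because each summand is a product: |τ τ'|⁴ ≤ (τ⁸
-- + τ'⁸)/2.
omit [IsProbabilityMeasure P] in
lemma mean_kernelDeriv_pow (h : IsBoundedSteinSequence P X p b) {n : ℕ} (hn : 1 ≤ n) :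
    Integrable (fun ω => (kernelDerivSum X p n ω / n) ^ 4) P ∧
      ∫ ω, (kernelDerivSum X p n ω / n) ^ 4 ∂P ≤ b := by
  have hn0 : (0 : ℝ) < n := by exact_mod_cast hn
  have hik : ∀ k, Integrable (fun ω => (steinKernel (p k) (X k ω) ^ 8 +
      deriv (steinKernel (p k)) (X k ω) ^ 8) / 2) P := fun k =>
    ((h.integrable_kernel_pow k).add (h.integrable_deriv_pow k)).div_const 2
  have hi : Integrable (fun ω => (∑ k ∈ Finset.range n, (steinKernel (p k) (X k ω) ^ 8 +
      deriv (steinKernel (p k)) (X k ω) ^ 8) / 2) / (n : ℝ)) P :=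
    (integrable_finsetSum _ fun k _ => hik k).div_const _
  have hle : ∀ ω, (kernelDerivSum X p n ω / n) ^ 4 ≤
      (∑ k ∈ Finset.range n, (steinKernel (p k) (X k ω) ^ 8 +
        deriv (steinKernel (p k)) (X k ω) ^ 8) / 2) / n := by
    intro ω
    have h1 := pow_sum_div_card_le_sum_pow (s := Finset.range n)
      (f := fun k => |steinKernel (p k) (X k ω) * deriv (steinKernel (p k)) (X k ω)|)
      (fun k _ => abs_nonneg _) 3
    rw [Finset.card_range] at h1
    have h2 : kernelDerivSum X p n ω ^ 4 ≤ (∑ k ∈ Finset.range n,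
        |steinKernel (p k) (X k ω) * deriv (steinKernel (p k)) (X k ω)|) ^ 4 := by
      rw [← Even.pow_abs (by decide : Even 4)]
      exact pow_le_pow_left₀ (abs_nonneg _) (Finset.abs_sum_le_sum_abs _ _) 4
    have h3 : ∀ x y : ℝ, |x * y| ^ 4 ≤ (x ^ 8 + y ^ 8) / 2 := fun x y => by
      rw [Even.pow_abs (by decide : Even 4)]
      nlinarith [sq_nonneg (x ^ 4 - y ^ 4)]
    rw [div_pow, le_div_iff₀ hn0]
    refine le_trans ?_ (h1.trans (Finset.sum_le_sum fun k _ => h3 _ _))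
    rw [div_mul_eq_mul_div, div_le_div_iff₀ (by positivity) (by positivity)]
    calc kernelDerivSum X p n ω ^ 4 * n * n ^ 3 = kernelDerivSum X p n ω ^ 4 * n ^ 4 := by ring
      _ ≤ _ := mul_le_mul_of_nonneg_right h2 (by positivity)
  have hint := hi.mono' (((h.measurable_kernelDerivSum n).div_const _).pow_const
    4).aestronglyMeasurable
    (ae_of_all _ fun ω => by rw [Real.norm_of_nonneg (by positivity)]; exact hle ω)
  refine ⟨hint, (integral_mono hint hi hle).trans ?_⟩
  rw [integral_div, integral_finsetSum _ fun k _ => hik k, div_le_iff₀ hn0]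
  have : ∀ k ∈ Finset.range n, ∫ ω, (steinKernel (p k) (X k ω) ^ 8 +
      deriv (steinKernel (p k)) (X k ω) ^ 8) / 2 ∂P ≤ b := fun k _ => by
    rw [integral_div, integral_add (h.integrable_kernel_pow k) (h.integrable_deriv_pow k)]
    linarith [h.integral_kernel_pow_le k, h.integral_deriv_pow_le k]
  refine (Finset.sum_le_sum this).trans (le_of_eq ?_)
  simp [mul_comm]

end IsBoundedSteinSequence

section

variable {Ω : Type*} [MeasurableSpace Ω] {P : Measure Ω}

/-- Reconciles two conventions: the inverse of 0 is ∞ in the negative moment but 0 in ℝ. Finiteness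
of the negative moment makes Y = 0 a null event. -/
lemma integrable_inv_pow_of_negMoment8 {Y : Ω → ℝ} {B : ℝ} (hB : 0 ≤ B) (hY : Measurable Y)
    (h : negMoment8 P Y ≤ ENNReal.ofReal B) :
    (∀ᵐ ω ∂P, Y ω ≠ 0) ∧ Integrable (fun ω => (Y ω)⁻¹ ^ 8) P ∧ ∫ ω, (Y ω)⁻¹ ^ 8 ∂P ≤ B := by
  refine ⟨?_, integrable_pow_eight_of_moment8 hB hY.inv (le_trans (lintegral_mono fun ω => ?_) h)⟩
  · have := ae_lt_top (f := fun ω => (‖Y ω‖ₑ ^ 8)⁻¹) (by fun_prop)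
      (h.trans_lt ENNReal.ofReal_lt_top).ne
    filter_upwards [this] with ω hω h0
    simp [h0] at hω
  · by_cases h0 : Y ω = 0
    · simp [h0]
    · rw [enorm_inv h0, ENNReal.inv_pow]

end

/-- Here w = σ_n. The factor 1/(√n w) becomes the rate 1/(nσ_n²) after squaring, and the numerator
is of order one. -/
lemma sub_weight_eq {n w g : ℝ} (hn : 0 < n) (hw : 0 < w) (hg : g ≠ 0) (y G g₂ : ℝ) :
    w⁻¹ * (√n * y) - (G / (w⁻¹ * (√n * (g / n))) +
      w⁻¹ * (√n * (g₂ / n / n)) / (w⁻¹ * (√n * (g / n))) ^ 2) =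
      (n * y - w * w * n * G / g - w * w * g₂ / g ^ 2) / (√n * w) := by
  have hr : √n ≠ 0 := (Real.sqrt_pos.2 hn).ne'
  have hrr := Real.mul_self_sqrt hn.le
  generalize √n = r at *
  subst hrr
  have := hw.ne'
  field_simp
  ring

/-- The bound of the quantities that enter the constant of the Fisher information bound. -/
def statisticBound (b h₁ h₂ : ℝ) : ℝ :=
  1 + h₁ + h₂ + 4 * (h₁ * h₂ + h₂ ^ 2) * (1 + momentConst * b)

/-- The constant of the Fisher information bound. -/
def fisherConst (b g h₁ h₂ : ℝ) : ℝ :=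
  98 * statisticBound b h₁ h₂ ^ 10 *
    (1 + momentConst * b + momentConst * (2 ^ 7 * (b + 1)) + g ^ 8 + b + b)

lemma momentConst_pos : 0 < momentConst := by norm_num [momentConst]

lemma one_le_statisticBound {b h₁ h₂ : ℝ} (hb : 0 ≤ b) (h1 : 0 ≤ h₁) (h2 : 0 ≤ h₂) :
    1 ≤ statisticBound b h₁ h₂ := by
  have := momentConst_pos
  have : 0 ≤ 4 * (h₁ * h₂ + h₂ ^ 2) * (1 + momentConst * b) := by positivity
  unfold statisticBound
  linarith

lemma fisherConst_pos {b g h₁ h₂ : ℝ} (hb : 0 ≤ b) (h1 : 0 ≤ h₁) (h2 : 0 ≤ h₂) :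
    0 < fisherConst b g h₁ h₂ := by
  have := momentConst_pos
  have := one_le_statisticBound hb h1 h2
  unfold fisherConst
  positivity

/-! ### Linearization, variance and Fisher information of the statistic. -/

namespace IsBoundedSteinSequence

variable {Ω : Type*} [MeasurableSpace Ω] {P : Measure Ω} [IsProbabilityMeasure P]
  {X : ℕ → Ω → ℝ} {p : ℕ → ℝ → ℝ} {b : ℝ} {H : ℝ → ℝ} {c h₁ h₂ : ℝ} {n : ℕ}

omit [IsProbabilityMeasure P] in
lemma measurable_statistic (h : IsBoundedSteinSequence P X p b) (hH : IsSmoothStatistic H c h₁ h₂)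
    (n : ℕ) : Measurable fun ω => H (partialSum X n ω / n) :=
  hH.measurable.comp ((h.measurable_partialSum n).div_const _)

lemma integrable_partialSum_pow (h : IsBoundedSteinSequence P X p b) (n : ℕ) {j : ℕ} (hj : j ≤ 8) :
    Integrable (fun ω => partialSum X n ω ^ j) P :=
  integrable_pow_of_pow_eight (h.measurable_partialSum n) (h.partialSum_pow n).1 hj

lemma integrable_partialSum (h : IsBoundedSteinSequence P X p b) (n : ℕ) :
    Integrable (partialSum X n) P :=
  integrable_of_pow_eight (h.measurable_partialSum n) (h.partialSum_pow n).1

lemma integrable_statistic (h : IsBoundedSteinSequence P X p b)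
    (hH : IsSmoothStatistic H c h₁ h₂) (n : ℕ) :
    Integrable (fun ω => H (partialSum X n ω / n)) P := by
  refine ((integrable_const |H 0|).add
    (((h.integrable_partialSum n).div_const n).norm.const_mul h₁)).mono'
    (h.measurable_statistic hH n).aestronglyMeasurable (ae_of_all _ fun ω => ?_)
  have h1 := hH.abs_sub_le (partialSum X n ω / n)
  have h2 := abs_add_le (H (partialSum X n ω / n) - H 0) (H 0)
  rw [sub_add_cancel] at h2
  simp only [Pi.add_apply, Real.norm_eq_abs]
  linarith

/-- The remainder of the linearization of the centered statistic. -/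
lemma abs_remainder_le (h : IsBoundedSteinSequence P X p b) (hH : IsSmoothStatistic H c h₁ h₂)
    (hn : 1 ≤ n) (ω : Ω) :
    n * |H (partialSum X n ω / n) - ∫ ω', H (partialSum X n ω' / n) ∂P -
      deriv H 0 * (partialSum X n ω / n)| ≤ h₂ * ((partialSum X n ω / √n) ^ 2 + 1) := by
  have hn0 : (0 : ℝ) < n := by exact_mod_cast hn
  -- The linear Taylor term has mean zero and E[X̄²] = 1/n.
  have hE : |∫ ω', H (partialSum X n ω' / n) ∂P - H 0| ≤ h₂ / n := by
    have i1 := h.integrable_statistic hH n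
    have i2 : Integrable (fun ω' => H (partialSum X n ω' / n) - H 0) P :=
      i1.sub (integrable_const _)
    have i3 : Integrable (fun ω' => deriv H 0 * (partialSum X n ω' / n)) P :=
      ((h.integrable_partialSum n).div_const _).const_mul _
    have e : ∫ ω', H (partialSum X n ω' / n) ∂P - H 0 =
        ∫ ω', (H (partialSum X n ω' / n) - H 0 - deriv H 0 * (partialSum X n ω' / n)) ∂P := by
      rw [integral_sub i2 i3, integral_sub i1 (integrable_const _), integral_const_mul,
        integral_div, h.integral_partialSum]
      simp
    have i4 : Integrable (fun ω' => h₂ * (partialSum X n ω' / n) ^ 2) P := by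
      simp_rw [div_pow]
      exact ((h.integrable_partialSum_pow n (by norm_num)).div_const _).const_mul _
    rw [e, ← Real.norm_eq_abs]
    refine (norm_integral_le_of_norm_le i4 (ae_of_all _ fun ω' => hH.abs_taylor_le _)).trans ?_
    rw [integral_const_mul]
    simp_rw [div_pow]
    rw [integral_div, h.integral_partialSum_sq]
    refine le_of_eq ?_
    field_simp
  have hT := hH.abs_taylor_le (partialSum X n ω / n)
  have htri := abs_sub (H (partialSum X n ω / n) - H 0 - deriv H 0 * (partialSum X n ω / n))
    (∫ ω', H (partialSum X n ω' / n) ∂P - H 0)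
  have e2 : H (partialSum X n ω / n) - H 0 - deriv H 0 * (partialSum X n ω / n) -
      (∫ ω', H (partialSum X n ω' / n) ∂P - H 0) =
      H (partialSum X n ω / n) - ∫ ω', H (partialSum X n ω' / n) ∂P -
      deriv H 0 * (partialSum X n ω / n) := by ring
  rw [e2] at htri
  refine (mul_le_mul_of_nonneg_left (htri.trans (add_le_add hT hE)) hn0.le).trans (le_of_eq ?_)
  rw [div_pow _ (√(n : ℝ)), Real.sq_sqrt hn0.le]
  field_simp

omit [IsProbabilityMeasure P] in
lemma _root_.integral_div_sqrt_pow_eight_le (hn : 1 ≤ n) {Y : Ω → ℝ} {B : ℝ}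
    (hY : Integrable (fun ω => Y ω ^ 8) P ∧ ∫ ω, Y ω ^ 8 ∂P ≤ B * (n : ℝ) ^ 4) :
    Integrable (fun ω => (Y ω / √n) ^ 8) P ∧ ∫ ω, (Y ω / √n) ^ 8 ∂P ≤ B := by
  have hn0 : (0 : ℝ) < n := by exact_mod_cast hn
  have e : √(n : ℝ) ^ 8 = (n : ℝ) ^ 4 := by
    rw [show 8 = 2 * 4 from rfl, pow_mul, Real.sq_sqrt hn0.le]
  simp_rw [div_pow, e]
  refine ⟨hY.1.div_const _, ?_⟩
  rw [integral_div, div_le_iff₀ (by positivity)]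
  exact hY.2

lemma variance_meanStat (h : IsBoundedSteinSequence P X p b) (hH : IsSmoothStatistic H c h₁ h₂)
    (n : ℕ) : variance (meanStat P H X n) P =
      n * ∫ ω, (H (partialSum X n ω / n) - ∫ ω', H (partialSum X n ω' / n) ∂P) ^ 2 ∂P := by
  have e : meanStat P H X n = fun ω => √(n : ℝ) * (H (partialSum X n ω / n) -
    ∫ ω', H (partialSum X n ω' / n) ∂P) := rfl
  have hm := h.measurable_statistic hH n
  have h0 : ∫ ω, meanStat P H X n ω ∂P = 0 := by
    rw [e, integral_const_mul, integral_sub (h.integrable_statistic hH n) (integrable_const _)]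
    simp
  rw [variance_of_integral_eq_zero ?_ h0]
  · rw [e]
    simp_rw [mul_pow, Real.sq_sqrt (Nat.cast_nonneg n)]
    rw [integral_const_mul]
  · rw [e]
    exact ((hm.sub_const _).const_mul _).aemeasurable

lemma integrable_sq_statistic (h : IsBoundedSteinSequence P X p b)
    (hH : IsSmoothStatistic H c h₁ h₂) (n : ℕ) (m : ℝ) :
    Integrable (fun ω => (H (partialSum X n ω / n) - m) ^ 2) P := by
  have hm := h.measurable_statistic hH n
  have i2 : Integrable (fun ω => (partialSum X n ω / n) ^ 2) P := by
    simp_rw [div_pow]; exact (h.integrable_partialSum_pow n (by norm_num)).div_const _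
  refine ((i2.const_mul (2 * h₁ ^ 2)).add (integrable_const (2 * (H 0 - m) ^ 2))).mono'
    ((hm.sub_const m).pow_const 2).aestronglyMeasurable (ae_of_all _ fun ω => ?_)
  rw [Real.norm_of_nonneg (sq_nonneg _)]
  have h1 := pow_le_pow_left₀ (abs_nonneg _) (hH.abs_sub_le (partialSum X n ω / n)) 2
  rw [sq_abs, mul_pow, sq_abs] at h1
  simp only [Pi.add_apply]
  nlinarith [sq_nonneg (H (partialSum X n ω / n) - H 0 - (H 0 - m))]

/-- Otherwise H(X̄) would be almost surely constant, hence S as well by injectivity of H; being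
centered, S would vanish, against E[S²] = n. -/
lemma variance_meanStat_pos (h : IsBoundedSteinSequence P X p b)
    (hH : IsSmoothStatistic H c h₁ h₂) (hn : 1 ≤ n) : 0 < variance (meanStat P H X n) P := by
  have hn0 : (0 : ℝ) < n := by exact_mod_cast hn
  refine lt_of_le_of_ne (variance_nonneg _ _) fun h0 => ?_
  rw [h.variance_meanStat hH n, eq_comm, mul_eq_zero, or_iff_right hn0.ne',
    integral_eq_zero_iff_of_nonneg (fun ω => sq_nonneg _) (h.integrable_sq_statistic hH n _)] at h0
  have hconst : ∀ᵐ ω ∂P, H (partialSum X n ω / n) = ∫ ω', H (partialSum X n ω' / n) ∂P := by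
    filter_upwards [h0] with ω hω
    simpa [sub_eq_zero] using hω
  obtain ⟨ω₀, hω₀⟩ := hconst.exists
  have hS : partialSum X n =ᵐ[P] fun _ => partialSum X n ω₀ := by
    filter_upwards [hconst] with ω hω
    have := hH.injective (hω.trans hω₀.symm)
    field_simp at this
    exact this
  have e1 := h.integral_partialSum n
  rw [integral_congr_ae hS] at e1
  simp only [integral_const, probReal_univ, smul_eq_mul, one_mul] at e1
  have e2 := h.integral_partialSum_sq n
  have hS2 : (fun ω => partialSum X n ω ^ 2) =ᵐ[P] fun _ => 0 := by
    filter_upwards [hS] with ω hω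
    rw [hω, e1]; norm_num
  rw [integral_congr_ae hS2, integral_zero] at e2
  exact hn0.ne e2

/-- H'(0)² is the variance of the linear part H'(0)S/√n. The difference of the squares factors
through the remainder of order 1/n, which gives the rate n^(-1/2) required by the cancellation in
`sq_stein_error_le`. -/
lemma abs_variance_sub_le (h : IsBoundedSteinSequence P X p b)
    (hH : IsSmoothStatistic H c h₁ h₂) (hn : 1 ≤ n) :
    √n * |variance (meanStat P H X n) P - deriv H 0 ^ 2| ≤
      4 * (h₁ * h₂ + h₂ ^ 2) * (1 + momentConst * b) := by
  have hn0 : (0 : ℝ) < n := by exact_mod_cast hn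
  have hn1 : (1 : ℝ) ≤ n := by exact_mod_cast hn
  have hr : 0 < √(n : ℝ) := Real.sqrt_pos.2 hn0
  have hrr : √(n : ℝ) * √n = n := Real.mul_self_sqrt hn0.le
  have hr1 : 1 ≤ √(n : ℝ) := Real.one_le_sqrt.2 hn1
  have hh1 := hH.nonneg₁
  have hh2 := hH.nonneg₂
  have hrem := h.abs_remainder_le hH hn
  have iy := h.integrable_sq_statistic hH n (∫ ω', H (partialSum X n ω' / n) ∂P)
  set m := ∫ ω', H (partialSum X n ω' / n) ∂P with hm
  have is : Integrable (fun ω => (deriv H 0 * (partialSum X n ω / n)) ^ 2) P := by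
    simp_rw [mul_pow, div_pow]
    exact ((h.integrable_partialSum_pow n (by norm_num)).div_const _).const_mul _
  have e0 : deriv H 0 ^ 2 = n * ∫ ω, (deriv H 0 * (partialSum X n ω / n)) ^ 2 ∂P := by
    simp_rw [mul_pow, div_pow]
    rw [integral_const_mul, integral_div, h.integral_partialSum_sq]
    field_simp
  have hV := integral_div_sqrt_pow_eight_le hn (h.partialSum_pow n)
  have hdiff : √(n : ℝ) * (variance (meanStat P H X n) P - deriv H 0 ^ 2) =
      ∫ ω, √(n : ℝ) * n * ((H (partialSum X n ω / n) - m) ^ 2 -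
        (deriv H 0 * (partialSum X n ω / n)) ^ 2) ∂P := by
    rw [integral_const_mul, integral_sub iy is, h.variance_meanStat hH n, e0]
    ring
  have habs : √(n : ℝ) * |variance (meanStat P H X n) P - deriv H 0 ^ 2| =
      |√(n : ℝ) * (variance (meanStat P H X n) P - deriv H 0 ^ 2)| := by
    rw [abs_mul, abs_of_pos hr]
  rw [habs, hdiff, ← Real.norm_eq_abs]
  have ib : Integrable (fun ω => 4 * (h₁ * h₂ + h₂ ^ 2) * (1 + (partialSum X n ω / √n) ^ 8)) P :=
    ((integrable_const (1 : ℝ)).add hV.1).const_mul _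
  refine (norm_integral_le_of_norm_le ib (ae_of_all _ fun ω => ?_)).trans ?_
  · set s := partialSum X n ω
    set y := H (s / n) - m with hy
    set ρ := y - deriv H 0 * (s / n) with hρ
    have hρ1 : n * |ρ| ≤ h₂ * ((s / √n) ^ 2 + 1) := hrem ω
    set x := |s / √n| with hx
    have hx0 : 0 ≤ x := abs_nonneg _
    rw [← sq_abs (s / √n), ← hx] at hρ1
    have x8 : (s / √n) ^ 8 = x ^ 8 := (abs_pow_eight _).symm
    have ax : |x| = x := abs_of_nonneg hx0
    have p1 := abs_pow_le_one_add_pow_eight (x := x) (show 1 ≤ 8 by norm_num)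
    have p2 := abs_pow_le_one_add_pow_eight (x := x) (show 2 ≤ 8 by norm_num)
    have p3 := abs_pow_le_one_add_pow_eight (x := x) (show 3 ≤ 8 by norm_num)
    have p4 := abs_pow_le_one_add_pow_eight (x := x) (show 4 ≤ 8 by norm_num)
    rw [ax] at p1 p2 p3 p4
    have e1 : √(n : ℝ) * n * (y ^ 2 - (deriv H 0 * (s / n)) ^ 2) =
        (n * ρ) * (2 * deriv H 0 * (s / √n) + √n * ρ) := by
      have : s / √n = √n * (s / n) := by
        rw [mul_div_assoc', div_eq_div_iff hr.ne' hn0.ne']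
        linear_combination (-s) * hrr
      rw [this, hρ]; ring
    have b2 : |2 * deriv H 0 * (s / √n) + √n * ρ| ≤ 2 * h₁ * x + h₂ * (x ^ 2 + 1) := by
      refine (abs_add_le _ _).trans (add_le_add ?_ ?_)
      · rw [abs_mul, abs_mul, abs_two]
        exact mul_le_mul_of_nonneg_right
          (mul_le_mul_of_nonneg_left (hH.abs_deriv_le 0) zero_le_two) hx0
      · rw [abs_mul, abs_of_pos hr]
        refine le_trans (mul_le_mul_of_nonneg_right ?_ (abs_nonneg _)) hρ1
        calc √(n : ℝ) ≤ √n * √n := le_mul_of_one_le_left hr.le hr1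
          _ = n := hrr
    rw [e1, norm_mul, norm_mul, Real.norm_of_nonneg hn0.le, Real.norm_eq_abs, Real.norm_eq_abs, x8]
    calc n * |ρ| * |2 * deriv H 0 * (s / √n) + √n * ρ|
        ≤ h₂ * (x ^ 2 + 1) * (2 * h₁ * x + h₂ * (x ^ 2 + 1)) :=
          mul_le_mul hρ1 b2 (abs_nonneg _) (by positivity)
      _ = h₁ * h₂ * (2 * x ^ 3 + 2 * x ^ 1) + h₂ ^ 2 * (x ^ 4 + 2 * x ^ 2 + 1) := by ring
      _ ≤ h₁ * h₂ * (4 * (1 + x ^ 8)) + h₂ ^ 2 * (4 * (1 + x ^ 8)) := by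
          have : 0 ≤ x ^ 8 := by positivity
          gcongr <;> linarith
      _ = _ := by ring
  · rw [integral_const_mul, integral_add (integrable_const _) hV.1]
    simp only [integral_const, probReal_univ, smul_eq_mul, mul_one]
    exact mul_le_mul_of_nonneg_left (by linarith [hV.2]) (by positivity)

/-- The Fisher information distance of the standardized statistic to the normal law is `O(1/n)`. -/
theorem fisherDist_meanStat_le (h : IsBoundedSteinSequence P X p b)
    (hH : IsSmoothStatistic H c h₁ h₂) (hn : 1 ≤ n) {g : ℝ}
    (hneg : negMoment8 P (nablaStat H X p n) ≤ ENNReal.ofReal (g ^ 8)) :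
    fisherDist P (fun ω => (√(variance (meanStat P H X n) P))⁻¹ * meanStat P H X n ω) 0 1 ≤
      ENNReal.ofReal (fisherConst b g h₁ h₂ / (n * variance (meanStat P H X n) P)) := by
  have hn0 : (0 : ℝ) < n := by exact_mod_cast hn
  have hn1 : (1 : ℝ) ≤ n := by exact_mod_cast hn
  have hh1 := hH.nonneg₁
  have hh2 := hH.nonneg₂
  have hb := h.nonneg
  have hvpos := h.variance_meanStat_pos hH hn
  have hvar := h.abs_variance_sub_le hH hn
  have hrem := h.abs_remainder_le hH hn
  have hFi := h.integrable_statistic hH n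
  have hstat : meanStat P H X n = fun ω => √(n : ℝ) * (H (partialSum X n ω / n) -
    ∫ ω', H (partialSum X n ω' / n) ∂P) := rfl
  have hnab : nablaStat H X p n = fun ω =>
    deriv H 0 * deriv H (partialSum X n ω / n) / n * steinSum X p n ω := rfl
  set m := ∫ ω', H (partialSum X n ω' / n) ∂P
  set v := variance (meanStat P H X n) P with hv
  have mS := h.measurable_partialSum n
  have mT := h.measurable_steinSum n
  have mQ := h.measurable_kernelDerivSum n
  have mH' : Measurable (deriv H) := measurable_deriv _
  have mnab : Measurable (nablaStat H X p n) := by rw [hnab]; fun_prop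
  obtain ⟨hne, hDi, hDle⟩ := integrable_inv_pow_of_negMoment8 (by positivity) mnab hneg
  rw [hnab] at hne hDi hDle
  simp only at hne hDi hDle
  have hT : ∀ᵐ ω ∂P, steinSum X p n ω ≠ 0 := by
    filter_upwards [hne] with ω hω h0
    exact hω (by rw [h0, mul_zero])
  -- T⁻¹ is ∇⁻¹ times the bounded factor H'(0)H'(X̄)/n.
  have hTinv : Integrable (fun ω => (steinSum X p n ω)⁻¹ ^ 8) P := by
    refine (hDi.const_mul ((h₁ * h₁) ^ 8)).mono' (by fun_prop : Measurable _).aestronglyMeasurable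
      (ae_of_all _ fun ω => ?_)
    rw [Real.norm_of_nonneg (by positivity)]
    have e : (steinSum X p n ω)⁻¹ = deriv H 0 * deriv H (partialSum X n ω / n) / n *
        (deriv H 0 * deriv H (partialSum X n ω / n) / n * steinSum X p n ω)⁻¹ := by
      have := hH.deriv_ne_zero 0
      have := hH.deriv_ne_zero (partialSum X n ω / n)
      rw [mul_inv, mul_inv_cancel_left₀]
      positivity
    rw [e, mul_pow]
    refine mul_le_mul_of_nonneg_right ?_ (by positivity)
    rw [← abs_pow_eight (_ / _), abs_div, abs_mul, abs_of_pos hn0]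
    refine pow_le_pow_left₀ (by positivity) ?_ 8
    refine (div_le_self (by positivity) hn1).trans ?_
    exact mul_le_mul (hH.abs_deriv_le _) (hH.abs_deriv_le _) (abs_nonneg _) hh1
  have hA := h.mean_kernelDeriv_pow hn
  have iS : Integrable (fun ω => partialSum X n ω / steinSum X p n ω) P := by
    refine (((h.partialSum_pow n).1.add hTinv).add (integrable_const 2)).mono'
      (by fun_prop : Measurable _).aestronglyMeasurable (ae_of_all _ fun ω => ?_)
    have q1 := abs_pow_le_one_add_pow_eight (x := partialSum X n ω) (show 2 ≤ 8 by norm_num)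
    have q2 := abs_pow_le_one_add_pow_eight (x := (steinSum X p n ω)⁻¹) (show 2 ≤ 8 by norm_num)
    rw [div_eq_mul_inv, norm_mul, Real.norm_eq_abs, Real.norm_eq_abs]
    simp only [Pi.add_apply]
    nlinarith [sq_nonneg (|partialSum X n ω| - |(steinSum X p n ω)⁻¹|),
      sq_nonneg (|partialSum X n ω| + |(steinSum X p n ω)⁻¹|)]
  have iQ : Integrable (fun ω => kernelDerivSum X p n ω / steinSum X p n ω ^ 2) P := by
    refine ((((hA.1.const_mul ((n : ℝ) ^ 4))).add hTinv).add (integrable_const 1)).mono'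
      (by fun_prop : Measurable _).aestronglyMeasurable (ae_of_all _ fun ω => ?_)
    rw [div_eq_mul_inv, ← inv_pow, norm_mul, norm_pow, Real.norm_eq_abs, Real.norm_eq_abs]
    have e : (n : ℝ) ^ 4 * (kernelDerivSum X p n ω / n) ^ 4 = |kernelDerivSum X p n ω| ^ 4 := by
      rw [Even.pow_abs (by decide : Even 4), div_pow]; field_simp
    simp only [Pi.add_apply]
    rw [e, ← abs_pow_eight (steinSum X p n ω)⁻¹]
    generalize |kernelDerivSum X p n ω| = a
    generalize |(steinSum X p n ω)⁻¹| = d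
    nlinarith [sq_nonneg (a - d ^ 2), sq_nonneg (a + d ^ 2), sq_nonneg (a ^ 2 - 1),
      sq_nonneg (d ^ 4 - 1), sq_nonneg (a ^ 2), sq_nonneg (d ^ 4)]
  set K := statisticBound b h₁ h₂ with hK
  have hK1 : 1 ≤ K := one_le_statisticBound hb hh1 hh2
  set c₁ := 4 * (h₁ * h₂ + h₂ ^ 2) * (1 + momentConst * b) with hc₁
  have hc₁0 : 0 ≤ c₁ := by
    have := momentConst_pos
    positivity
  have hKe : K = 1 + h₁ + h₂ + c₁ := rfl
  have hKh1 : h₁ ≤ K := by linarith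
  have hKh2 : h₂ ≤ K := by linarith
  have hKc : c₁ ≤ K := by linarith
  have hr1 : 1 ≤ √(n : ℝ) := Real.one_le_sqrt.2 hn1
  have hr : 0 < √(n : ℝ) := by linarith
  have hrr : √(n : ℝ) * √n = n := Real.mul_self_sqrt hn0.le
  have hvK : v ≤ K ^ 2 := by
    have h1 : |v - deriv H 0 ^ 2| ≤ c₁ :=
      (le_mul_of_one_le_left (abs_nonneg _) hr1).trans hvar
    have h2 := (abs_le.1 h1).2
    have h3 : deriv H 0 ^ 2 ≤ h₁ ^ 2 := by
      rw [← sq_abs]; exact pow_le_pow_left₀ (abs_nonneg _) (hH.abs_deriv_le 0) 2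
    rw [hKe]
    nlinarith [mul_nonneg hh1 hc₁0, mul_nonneg hh2 hc₁0, mul_nonneg hh1 hh2, sq_nonneg h₂,
      sq_nonneg c₁]
  set w := √v with hw
  have hw0 : 0 < w := Real.sqrt_pos.2 hvpos
  have hww : w * w = v := Real.mul_self_sqrt hvpos.le
  have hdiv : ∀ x : ℝ, HasDerivAt (fun x : ℝ => x / n) (1 / (n : ℝ)) x := fun x =>
    (hasDerivAt_id x).div_const _
  -- The lower bound of |f'| built from `c` only justifies the integration by parts; it does not
  -- enter the resulting estimate.
  have main := h.toIsSteinSequence.fisherDist_le (n := n)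
    (f := fun s => w⁻¹ * (√n * (H (s / n) - m)))
    (f' := fun s => w⁻¹ * (√n * (deriv H (s / n) / n)))
    (f'' := fun s => w⁻¹ * (√n * (deriv (deriv H) (s / n) / n / n)))
    (c := w⁻¹ * (√n * (c / n))) (K := w⁻¹ * (√n * (h₂ / n / n)))
    (fun x => by
      have := ((((hH.differentiable (x / n)).hasDerivAt.comp x (hdiv x)).sub_const m).const_mul
        (√(n : ℝ))).const_mul w⁻¹
      exact this.congr_deriv (by ring))
    (fun x => by
      have := ((((hH.differentiable_deriv (x / n)).hasDerivAt.comp x (hdiv x)).div_const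
        (n : ℝ)).const_mul (√(n : ℝ))).const_mul w⁻¹
      exact this.congr_deriv (by ring))
    (by have := hH.pos; positivity)
    (fun x => by
      rw [abs_mul, abs_mul, abs_div, abs_of_pos (inv_pos.2 hw0), abs_of_pos hr, abs_of_pos hn0]
      have := hH.le_abs_deriv (x / n)
      gcongr)
    (fun x => by
      rw [abs_mul, abs_mul, abs_div, abs_div, abs_of_pos (inv_pos.2 hw0), abs_of_pos hr,
        abs_of_pos hn0]
      have := hH.abs_deriv_deriv_le (x / n)
      gcongr)
    (by
      have : Measurable (deriv (deriv H)) := measurable_deriv _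
      fun_prop)
    (((hFi.sub (integrable_const m)).const_mul _).const_mul _) hT iS iQ
  set Sig : Ω → ℝ := fun ω => 1 + (partialSum X n ω / √n) ^ 8 +
    ((steinSum X p n ω - n) / √n) ^ 8 +
    ((deriv H 0 * deriv H (partialSum X n ω / n) / n * steinSum X p n ω)⁻¹) ^ 8 +
    (kernelDerivSum X p n ω / n) ^ 4 + (steinSum X p n ω / n) ^ 8 with hSig
  have hV := integral_div_sqrt_pow_eight_le hn (h.partialSum_pow n)
  have hW := integral_div_sqrt_pow_eight_le hn (h.steinSum_sub_pow n)
  have hB := h.mean_pow hn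
  have j1 : Integrable (fun ω => 1 + (partialSum X n ω / √n) ^ 8) P :=
    (integrable_const (1 : ℝ)).add hV.1
  have j2 := j1.add hW.1
  have j3 := j2.add hDi
  have j4 := j3.add hA.1
  have j5 : Integrable Sig P := j4.add hB.1
  have hSigle : ∫ ω, Sig ω ∂P ≤ 1 + momentConst * b + momentConst * (2 ^ 7 * (b + 1)) + g ^ 8 +
      b + b := by
    have e : ∫ ω, Sig ω ∂P = 1 + ∫ ω, (partialSum X n ω / √n) ^ 8 ∂P +
        ∫ ω, ((steinSum X p n ω - n) / √n) ^ 8 ∂P +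
        ∫ ω, ((deriv H 0 * deriv H (partialSum X n ω / n) / n * steinSum X p n ω)⁻¹) ^ 8 ∂P +
        ∫ ω, (kernelDerivSum X p n ω / n) ^ 4 ∂P + ∫ ω, (steinSum X p n ω / n) ^ 8 ∂P := by
      have e5 := integral_add' j4 hB.1
      have e4 := integral_add' j3 hA.1
      have e3 := integral_add' j2 hDi
      have e2 := integral_add' j1 hW.1
      have e1 : ∫ ω, (1 + (partialSum X n ω / √n) ^ 8) ∂P =
          1 + ∫ ω, (partialSum X n ω / √n) ^ 8 ∂P := by
        rw [integral_add (integrable_const _) hV.1]; simp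
      rw [← e1, ← e2, ← e3, ← e4, ← e5]
      rfl
    rw [e]
    linarith [hV.2, hW.2, hDle, hA.2, hB.2]
  have hpt : ∀ᵐ ω ∂P, (w⁻¹ * (√n * (H (partialSum X n ω / n) - m)) -
      steinWeight X p (fun s => w⁻¹ * (√n * (deriv H (s / n) / n)))
        (fun s => w⁻¹ * (√n * (deriv (deriv H) (s / n) / n / n))) n ω) ^ 2 ≤
      98 * K ^ 10 * Sig ω / (n * v) := by
    filter_upwards [hT] with ω hTω
    have hTpos : 0 < steinSum X p n ω := lt_of_le_of_ne (h.steinSum_nonneg n ω) hTω.symm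
    have hrω := hrem ω
    have key := sq_stein_error_le (K := K) (n := n) (s := partialSum X n ω)
      (t := steinSum X p n ω) (q := kernelDerivSum X p n ω) (v := v)
      (y := H (partialSum X n ω / n) - m)
      (ρ := H (partialSum X n ω / n) - m - deriv H 0 * (partialSum X n ω / n))
      (g₀ := deriv H 0) (g := deriv H (partialSum X n ω / n))
      (g₂ := deriv (deriv H) (partialSum X n ω / n)) hK1 hn1 hTpos (hH.deriv_ne_zero _)
      (hH.deriv_ne_zero _) ((hH.abs_deriv_le _).trans hKh1) ((hH.abs_deriv_le _).trans hKh1)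
      ((hH.abs_deriv_deriv_le _).trans hKh2) hvpos.le hvK
      ((hH.abs_deriv_sub_le _).trans (by
        rw [abs_div, abs_of_pos hn0]
        exact mul_le_mul_of_nonneg_right hKh2 (by positivity)))
      (hvar.trans hKc)
      (hrω.trans (mul_le_mul_of_nonneg_right hKh2 (by positivity))) (by ring)
    have e : w⁻¹ * (√n * (H (partialSum X n ω / n) - m)) -
        steinWeight X p (fun s => w⁻¹ * (√n * (deriv H (s / n) / n)))
          (fun s => w⁻¹ * (√n * (deriv (deriv H) (s / n) / n / n))) n ω =
        (n * (H (partialSum X n ω / n) - m) - v * n * (partialSum X n ω / steinSum X p n ω +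
          kernelDerivSum X p n ω / steinSum X p n ω ^ 2) / deriv H (partialSum X n ω / n) -
          v * deriv (deriv H) (partialSum X n ω / n) / deriv H (partialSum X n ω / n) ^ 2) /
            (√n * w) := by
      rw [← hww]
      exact sub_weight_eq hn0 hw0 (hH.deriv_ne_zero _) _ _ _
    rw [e, div_pow, mul_pow, Real.sq_sqrt hn0.le, sq w, hww]
    exact div_le_div_of_nonneg_right key (by positivity)
  have hlast := lintegral_mono_ae (hpt.mono fun ω hω => ENNReal.ofReal_le_ofReal hω)
  rw [← ofReal_integral_eq_lintegral_ofReal ((j5.const_mul _).div_const _)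
    (ae_of_all _ fun ω => by
      have : 0 ≤ Sig ω := by simp only [hSig]; positivity
      positivity), integral_div, integral_const_mul] at hlast
  refine (main.trans hlast).trans (ENNReal.ofReal_le_ofReal ?_)
  refine div_le_div_of_nonneg_right ?_ (by positivity)
  exact mul_le_mul_of_nonneg_left hSigle (by positivity)

/-- Uniform boundedness of the negative moments of `∇_{Fₙ}`. -/
theorem gammaConst_lt_top (h : IsBoundedSteinSequence P X p b) (hH : IsSmoothStatistic H c h₁ h₂)
    {n₀ : ℕ} (hn₀ : 1 ≤ n₀) (hneg : negMoment8 P (steinSum X p n₀) < ∞) :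
    gammaConst P H X p n₀ < ∞ := by
  -- The second moments are bounded through τ² ≤ 1 + τ⁸.
  obtain ⟨K, hK, hle⟩ := exists_negMoment8_sum_le (M := 1 + b) (n₀ := n₀)
    (h.measurable_kernel) (h.indep.comp (fun k x => steinKernel (p k) x)
      fun k => (h.density k).measurable_steinKernel)
    (fun k ω => (h.density k).steinKernel_nonneg _) h.integrable_kernel
    (fun k => integrable_pow_of_pow_eight (h.measurable_kernel k) (h.integrable_kernel_pow k)
      (by norm_num)) h.integral_kernel
    (fun k => by
      refine (integral_mono (integrable_pow_of_pow_eight (h.measurable_kernel k)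
        (h.integrable_kernel_pow k) (by norm_num)) ((integrable_const (1 : ℝ)).add
        (h.integrable_kernel_pow k)) fun ω => ?_).trans ?_
      · have := abs_pow_le_one_add_pow_eight (x := steinKernel (p k) (X k ω))
          (show 2 ≤ 8 by norm_num)
        rwa [sq_abs] at this
      · rw [integral_add' (integrable_const _) (h.integrable_kernel_pow k)]
        simpa using h.integral_kernel_pow_le k) hneg
  have hc := hH.pos
  -- Pointwise |∇| ≥ c²T/n, so only n⁸E[T⁻⁸] has to be bounded uniformly.
  have key : ∀ n ≥ n₀, negMoment8 P (nablaStat H X p n) ≤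
      ENNReal.ofReal ((c * c) ^ 8)⁻¹ * K := by
    intro n hn
    have hn0 : (0 : ℝ) < n := by exact_mod_cast hn₀.trans hn
    refine le_trans ?_ (mul_le_mul_of_nonneg_left (hle n hn) (by simp))
    rw [← mul_assoc, ← ENNReal.ofReal_mul (by positivity)]
    unfold negMoment8
    rw [← lintegral_const_mul' _ _ ENNReal.ofReal_ne_top]
    refine lintegral_mono fun ω => ?_
    have hA : 0 < |deriv H 0 * deriv H (sampleMean X n ω) / n| :=
      abs_pos.2 (div_ne_zero (mul_ne_zero (hH.deriv_ne_zero _) (hH.deriv_ne_zero _)) hn0.ne')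
    have e : ‖nablaStat H X p n ω‖ₑ = ENNReal.ofReal |deriv H 0 * deriv H (sampleMean X n ω) / n| *
        ‖steinSum X p n ω‖ₑ := by
      rw [nablaStat, enorm_mul, ← Real.enorm_abs, Real.enorm_of_nonneg (abs_nonneg _)]
    have hinv : ∀ x : ℝ≥0∞, (ENNReal.ofReal |deriv H 0 * deriv H (sampleMean X n ω) / n| ^ 8 *
        x)⁻¹ = (ENNReal.ofReal |deriv H 0 * deriv H (sampleMean X n ω) / n| ^ 8)⁻¹ * x⁻¹ := fun x =>
      ENNReal.mul_inv (Or.inl (by simpa using hA)) (Or.inl (by simp))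
    simp only
    rw [e, mul_pow, hinv]
    refine mul_le_mul_of_nonneg_right ?_ (by simp)
    rw [← ENNReal.ofReal_pow (abs_nonneg _), ← ENNReal.ofReal_inv_of_pos (by positivity)]
    refine ENNReal.ofReal_le_ofReal ?_
    rw [← inv_inv ((n : ℝ) ^ 8), ← mul_inv]
    refine inv_anti₀ (by positivity) ?_
    rw [abs_div, abs_mul, abs_of_pos hn0, div_pow, ← div_eq_mul_inv]
    have := hH.le_abs_deriv
    have h1 := mul_le_mul (this 0) (this (sampleMean X n ω)) hc.le (abs_nonneg _)
    gcongr
  refine lt_of_le_of_lt (iSup₂_le fun n hn =>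
    ENNReal.rpow_le_rpow (key n hn) (by norm_num : (0 : ℝ) ≤ 1 / 8)) ?_
  exact ENNReal.rpow_lt_top_of_nonneg (by norm_num)
    (ENNReal.mul_lt_top ENNReal.ofReal_lt_top hK).ne

end IsBoundedSteinSequence

/-! ### From the constants β and γ to real moment bounds. -/

lemma negMoment8_le_gammaConst {Ω : Type*} [MeasurableSpace Ω] {P : Measure Ω} {X : ℕ → Ω → ℝ}
    {p : ℕ → ℝ → ℝ} {H : ℝ → ℝ} {n₀ n : ℕ} (h : gammaConst P H X p n₀ < ∞) (hn : n₀ ≤ n) :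
    negMoment8 P (nablaStat H X p n) ≤
      ENNReal.ofReal ((gammaConst P H X p n₀).toReal ^ 8) := by
  have h1 : invNorm8 P (nablaStat H X p n) ≤ gammaConst P H X p n₀ := by
    unfold gammaConst
    exact le_iSup₂_of_le n hn le_rfl
  have h2 : negMoment8 P (nablaStat H X p n) = invNorm8 P (nablaStat H X p n) ^ 8 := by
    rw [invNorm8, ← ENNReal.rpow_natCast, ← ENNReal.rpow_mul]
    norm_num
  rw [h2, ENNReal.ofReal_pow ENNReal.toReal_nonneg, ENNReal.ofReal_toReal h.ne]
  exact pow_le_pow_left₀ (by simp) h1 8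

lemma isBoundedSteinSequence_of_betaConst {Ω : Type*} [MeasurableSpace Ω] {P : Measure Ω}
    [IsProbabilityMeasure P] {X : ℕ → Ω → ℝ} {p : ℕ → ℝ → ℝ} (hX : ∀ k, Measurable (X k))
    (hind : iIndepFun X P) (h0 : ∀ k, ∫ ω, X k ω ∂P = 0) (h1 : ∀ k, variance (X k) P = 1)
    (hp : ∀ k, IsIntervalDensity (P.map (X k)) (p k)) (hβ : betaConst P X p < ∞) :
    IsBoundedSteinSequence P X p (betaConst P X p).toReal := by
  have hb : 0 ≤ (betaConst P X p).toReal := ENNReal.toReal_nonneg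
  have heq : ENNReal.ofReal (betaConst P X p).toReal = betaConst P X p :=
    ENNReal.ofReal_toReal hβ.ne
  have m1 := fun k => integrable_pow_eight_of_moment8 (P := P) hb (hX k) (by
    rw [heq]
    exact (le_iSup (fun k => moment8 P (X k)) k).trans (le_max_left _ _))
  have hd : ∀ k, IsCenteredDensity (P.map (X k)) (p k) := fun k =>
    { toIsIntervalDensity := hp k
      integrable_id := (integrable_map_measure (by fun_prop) (hX k).aemeasurable).2
        (integrable_of_pow_eight (hX k) (m1 k).1)
      integral_id := by
        rw [integral_map (hX k).aemeasurable (by fun_prop), h0 k] }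
  have mτ : ∀ k, Measurable fun ω => steinKernel (p k) (X k ω) := fun k =>
    (hd k).measurable_steinKernel.comp (hX k)
  have mτ' : ∀ k, Measurable fun ω => deriv (steinKernel (p k)) (X k ω) := fun k =>
    (measurable_deriv _).comp (hX k)
  have m2 := fun k => integrable_pow_eight_of_moment8 (P := P) hb (mτ k) (by
    rw [heq]
    exact (le_iSup (fun k => moment8 P fun ω => steinKernel (p k) (X k ω)) k).trans
      ((le_max_left _ _).trans (le_max_right _ _)))
  have m3 := fun k => integrable_pow_eight_of_moment8 (P := P) hb (mτ' k) (by
    rw [heq]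
    exact (le_iSup (fun k => moment8 P fun ω => deriv (steinKernel (p k)) (X k ω)) k).trans
      ((le_max_right _ _).trans (le_max_right _ _)))
  exact
    { measurable := hX
      indep := hind
      density := hd
      integrable_kernel := fun k => integrable_of_pow_eight (mτ k) (m2 k).1
      integrable_kernel_mul_deriv := fun k => by
        refine (((integrable_pow_of_pow_eight (mτ k) (m2 k).1 (j := 2) (by norm_num)).add
          (integrable_pow_of_pow_eight (mτ' k) (m3 k).1 (j := 2) (by norm_num)))).mono'
          ((mτ k).mul (mτ' k)).aestronglyMeasurable (ae_of_all _ fun ω => ?_)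
        rw [Real.norm_eq_abs, abs_le]
        simp only [Pi.add_apply]
        constructor <;>
          nlinarith [sq_nonneg (steinKernel (p k) (X k ω) - deriv (steinKernel (p k)) (X k ω)),
            sq_nonneg (steinKernel (p k) (X k ω) + deriv (steinKernel (p k)) (X k ω))]
      integral_sq := fun k => by
        rw [← h1 k, variance_of_integral_eq_zero (hX k).aemeasurable (h0 k)]
      integrable_pow := fun k => (m1 k).1
      integral_pow_le := fun k => (m1 k).2
      integrable_kernel_pow := fun k => (m2 k).1
      integral_kernel_pow_le := fun k => (m2 k).2
      integrable_deriv_pow := fun k => (m3 k).1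
      integral_deriv_pow_le := fun k => (m3 k).2 }

lemma isSmoothStatistic_of_bddAbove {H : ℝ → ℝ} (hH : Differentiable ℝ H)
    (hH' : Differentiable ℝ (deriv H)) (h1 : BddAbove (Set.range fun x => |deriv H x|))
    (h2 : BddAbove (Set.range fun x => |deriv (deriv H) x|)) (h0 : 0 < ⨅ x, |deriv H x|) :
    IsSmoothStatistic H (⨅ x, |deriv H x|) (supNorm (deriv H)) (supNorm (deriv (deriv H))) where
  differentiable := hH
  differentiable_deriv := hH'
  pos := h0
  le_abs_deriv x := ciInf_le ⟨0, by rintro _ ⟨y, rfl⟩; exact abs_nonneg _⟩ x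
  abs_deriv_le x := le_ciSup h1 x
  abs_deriv_deriv_le x := le_ciSup h2 x

end

theorem corollary4p2 :
    -- the constant is a function of `β`, `γ`, `‖H'‖_∞` and `‖H''‖_∞` alone
    ∃ C : ℝ → ℝ → ℝ → ℝ → ℝ, (∀ b g h₁ h₂, 0 < C b g h₁ h₂) ∧
      ∀ (Ω : Type*) [MeasurableSpace Ω] (P : Measure Ω) [IsProbabilityMeasure P]
        (X : ℕ → Ω → ℝ) (p : ℕ → ℝ → ℝ) (H : ℝ → ℝ) (n₀ : ℕ),
        (∀ k, Measurable (X k)) →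
        iIndepFun X P →
        (∀ k, ∫ ω, X k ω ∂P = 0) →
        (∀ k, variance (X k) P = 1) →
        (∀ k, IsIntervalDensity (P.map (X k)) (p k)) →
        betaConst P X p < ∞ →
        Differentiable ℝ H →
        Differentiable ℝ (deriv H) →
        BddAbove (Set.range fun x => |deriv H x|) →
        BddAbove (Set.range fun x => |deriv (deriv H) x|) →
        0 < ⨅ x, |deriv H x| →
        1 ≤ n₀ →
        negMoment8 P (steinSum X p n₀) < ∞ →
        gammaConst P H X p n₀ < ∞ ∧
        ∀ n, n₀ ≤ n →
          0 < variance (meanStat P H X n) P ∧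
          fisherDist P
              (fun ω => (√(variance (meanStat P H X n) P))⁻¹ * meanStat P H X n ω) 0 1 ≤
            ENNReal.ofReal
              (C (betaConst P X p).toReal (gammaConst P H X p n₀).toReal
                  (supNorm (deriv H)) (supNorm (deriv (deriv H))) /
                (n * variance (meanStat P H X n) P)) := by

  -- The absolute values make the constant positive for all real arguments; they disappear at the
  -- actual ones, which are nonnegative.
  refine ⟨fun b g h₁ h₂ => fisherConst |b| |g| |h₁| |h₂|, fun b g h₁ h₂ =>
    fisherConst_pos (abs_nonneg _) (abs_nonneg _) (abs_nonneg _), ?_⟩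
  intro Ω _ P _ X p H n₀ hX hind h0 h1 hp hβ hH hH' hb1 hb2 hinf hn₀ hneg
  have hB := isBoundedSteinSequence_of_betaConst hX hind h0 h1 hp hβ
  have hS := isSmoothStatistic_of_bddAbove hH hH' hb1 hb2 hinf
  have hγ := hB.gammaConst_lt_top hS hn₀ hneg
  refine ⟨hγ, fun n hn => ⟨hB.variance_meanStat_pos hS (hn₀.trans hn), ?_⟩⟩
  simp only
  rw [abs_of_nonneg ENNReal.toReal_nonneg, abs_of_nonneg ENNReal.toReal_nonneg,
    abs_of_nonneg hS.nonneg₁, abs_of_nonneg hS.nonneg₂]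
  exact hB.fisherDist_meanStat_le hS (hn₀.trans hn)
    (negMoment8_le_gammaConst hγ hn)
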